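/- **Theorem 1 (Local existence and uniqueness).** Let $\alpha\in(0,1)$, $\gamma=1-\alpha$ and $0<q<\gamma$. For $s\in\mathbb R$ and $f:\mathbb R\to\mathbb R$ put $\|f\|_s=\sup_{x\ge 0}|f(x)|(1+x)^{-s}$. For odd $f$ let $$u[f](x)=-\int_0^\infty\Big(\frac1{|y-x|^{\gamma}}-\frac1{|x+y|^{\gamma}}\Big)f(y)\,dy ,$$ which is the velocity $-\int_{\mathbb R}|y-x|^{-\gamma}f(y)\,dy$ of the $\alpha$-patch model, understood by pairing $y$ with $-y$. Let $\omega_0\in C^2(\mathbb R)$ be odd with $$\|\omega_0\|_q+\|\omega_0'\|_{q-1}+\|\omega_0''\|_{q-2}<\infty .$$ Then there is a $T>0$ for which there exists exactly one function $\omega:[0,T]\times\mathbb R\to\mathbb R$ such that - $\omega\in C^1([0,T]\times\mathbb R)$, with one-sided time derivatives at $t=0$ and $t=T$; - $\omega(t,\cdot)$ is odd and $\|\omega(t,\cdot)\|_q+\|\omega_x(t,\cdot)\|_{q-1}<\infty$ for every $t\in[0,T]$; - $\omega_t+u[\omega]\,\omega_x=0$ on $[0,T]\times\mathbb R$, where $u[\omega](t,x)=u[\omega(t,\cdot)](x)$;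 - $\omega(0,\cdot)=\omega_0$. -/

import Mathlib

open Set MeasureTheory
open scoped ENNReal

noncomputable section

namespace AlphaPatch

/-- The weighted sup norm `‖f‖_s = sup_{x ≥ 0} |f x| (1 + x)^{-s}`, with values in `[0, ∞]`. -/
def weightedNorm (s : ℝ) (f : ℝ → ℝ) : ℝ≥0∞ :=
  ⨆ (x : ℝ) (_ : 0 ≤ x), ENNReal.ofReal (|f x| * (1 + x) ^ (-s))

/-- The kernel `K(x, y) = |y - x|^{-γ} - |x + y|^{-γ}`. -/
def kernel (γ x y : ℝ) : ℝ :=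
  1 / |y - x| ^ γ - 1 / |x + y| ^ γ

/-- The velocity field `u[f](x) = -∫_ℝ |y - x|^{-γ} f(y) dy` of an odd function `f`. The integral
over the line need not converge absolutely when `f` grows at infinity; it is understood by pairing
`y` with `-y`, i.e. as `-∫_0^∞ K(x, y) f(y) dy`, which converges absolutely for every continuous
`f` with `‖f‖_q < ∞` for some `q < γ`. -/
def velocity (γ : ℝ) (f : ℝ → ℝ) (x : ℝ) : ℝ :=
  -∫ y in Ioi (0 : ℝ), kernel γ x y * f y

/-- `ω` is an odd classical solution on `[0, T] × ℝ` of `ω_t + u[ω] ω_x = 0`, `ω(0, ·) = ω₀`, in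
the class `‖ω(t, ·)‖_q + ‖ω_x(t, ·)‖_{q-1} < ∞` for all `t ∈ [0, T]`. Only the values of `ω` on
`[0, T] × ℝ` matter; time derivatives at `t = 0` and `t = T` are one-sided. -/
structure IsSolution (γ q T : ℝ) (ω₀ : ℝ → ℝ) (ω : ℝ → ℝ → ℝ) : Prop where
  contDiffOn : ContDiffOn ℝ 1 (fun p : ℝ × ℝ => ω p.1 p.2) (Icc 0 T ×ˢ univ)
  odd : ∀ t ∈ Icc 0 T, ∀ x, ω t (-x) = -ω t x
  growth : ∀ t ∈ Icc 0 T,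
    weightedNorm q (ω t) + weightedNorm (q - 1) (deriv (ω t)) < ∞
  initial : ∀ x, ω 0 x = ω₀ x
  equation : ∀ t ∈ Icc 0 T, ∀ x,
    derivWithin (fun s => ω s x) (Icc 0 T) t + velocity γ (ω t) x * deriv (ω t) x = 0

end AlphaPatch

end

noncomputable section

namespace AlphaPatch

open Filter Topology
open scoped BoundedContinuousFunction

/-! ### A weighted maximum principle for transport equations on a half-line -/

/-! Existence is Lagrangian. Let `X(t, ·)` be the flow of `u[ω]` and `v = X_x - 1`. Since `u[ω]` is
a primitive of `-∫ |x - y|^{-γ} ω_x(y) dy`, and `ω_x(X(y)) X_y(y) = ω₀'(y)`, a change of variables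
gives the autonomous ODE `v' = (1 + v) S(v)` with `S(v)(x) = -∫ |X(x) - X(y)|^{-γ} ω₀'(y) dy`, posed
on bounded continuous functions. No derivative is lost: for `‖v‖ ≤ 1/2` the flow is bi-Lipschitz,
kernels for `v` and `w` differ by at most `4 ‖v - w‖ |x - y|^{-γ}`, and `∫ |x - y|^{-γ} (1 + |y|)^{q
- 1} dy` is bounded in `x`. Picard-Lindelöf (`exists_lagrangian_solution`) yields `v`, and `ω₀ ∘
X⁻¹` solves the equation (`velocity_comp_labelMap`, `exists_solution`), with a weighted bound on
`ω_x` uniform in time.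

Uniqueness compares an arbitrary solution `ω₂` with this `ω₁`. The difference solves `φ_t + u[ω₂]
φ_x = -u[φ] ∂ₓω₁`. In the weight `(1 + x)^p`, `q < p < γ`, the decay of `∂ₓω₁` absorbs the growth of
`u[φ]`, and a weighted maximum principle (`weighted_bound_of_transport`) forces `φ = 0`
(`IsSolution.eq_of_uniform_deriv_bound`).

This needs `u[ω₂]` to grow linearly with a constant uniform in time, while the solution class only
asks for a finite norm at each time. `IsSolution.exists_uniform_bound` fills the gap. In the weight
`(L + x)^q` the growth rate carries a factor `L^{q - γ}`, so for `L` large in terms of the norm at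
one endpoint the norm at most doubles, forwards or backwards, on any interval where it is known to
be bounded at all. A Baire category argument (`exists_Icc_subset_of_endpoint_control`) upgrades this
to a uniform bound. -/

theorem hasDerivWithinAt_nonneg_of_forall_le {f : ℝ → ℝ} {f' a c t : ℝ}
    (hf : HasDerivWithinAt f f' (Icc a c) t) (hat : a < t) (htc : t ≤ c)
    (hmax : ∀ s ∈ Icc a c, f s ≤ f t) : 0 ≤ f' := by
  have h1 : HasDerivWithinAt f f' (Ico a t) t :=
    hf.mono fun s hs => ⟨hs.1, hs.2.le.trans htc⟩
  rw [hasDerivWithinAt_iff_tendsto_slope' (by simp)] at h1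
  have : (𝓝[Ico a t] t).NeBot := by
    rw [nhdsWithin_Ico_eq_nhdsLT hat]; infer_instance
  refine ge_of_tendsto h1 ?_
  filter_upwards [self_mem_nhdsWithin] with s hs
  rw [slope_def_field]
  exact div_nonneg_of_nonpos (by linarith [hmax s ⟨hs.1, hs.2.le.trans htc⟩])
    (by linarith [hs.2])

/-- Since `q < p`, the weighted function tends to `0` as `x → ∞`, uniformly in `t`. The value at
`(t₁, x₁)` is positive and so beats the tail, which leaves a compact rectangle. -/
theorem exists_forall_weighted_le_of_growth {φ : ℝ → ℝ → ℝ} {a c L q p N t₁ x₁ l : ℝ}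
    (hL : 1 ≤ L) (hqp : q < p)
    (hcont : ContinuousOn (fun z : ℝ × ℝ => φ z.1 z.2) (Icc a c ×ˢ Ici 0))
    (hgrowth : ∀ t ∈ Icc a c, ∀ x, 0 ≤ x → |φ t x| ≤ N * (L + x) ^ q)
    (hl : 0 ≤ l) (ht₁ : t₁ ∈ Icc a c) (hx₁ : 0 ≤ x₁) (hne : φ t₁ x₁ ≠ 0) :
    ∃ t₀ ∈ Icc a c, ∃ x₀, 0 ≤ x₀ ∧ ∀ t ∈ Icc a c, ∀ x, 0 ≤ x →
      |φ t x| * Real.exp (-(l * (t - a))) * (L + x) ^ (-p) ≤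
        |φ t₀ x₀| * Real.exp (-(l * (t₀ - a))) * (L + x₀) ^ (-p) := by
  set G : ℝ × ℝ → ℝ := fun z => |φ z.1 z.2| * Real.exp (-(l * (z.1 - a))) * (L + z.2) ^ (-p)
    with hG
  have hGc : ContinuousOn G (Icc a c ×ˢ Ici 0) := by
    refine (hcont.abs.mul (by fun_prop)).mul ?_
    refine ContinuousOn.rpow_const (by fun_prop) fun z hz => Or.inl ?_
    have : (0 : ℝ) ≤ z.2 := hz.2
    linarith
  have hpos : 0 < G (t₁, x₁) := by
    have : 0 < L + x₁ := by linarith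
    have := abs_pos.2 hne
    simp only [hG]
    positivity
  have hdecay : ∀ t ∈ Icc a c, ∀ x, 0 ≤ x → G (t, x) ≤ N * (L + x) ^ (-(p - q)) := by
    intro t ht x hx
    have hLx : 0 < L + x := by linarith
    have h1 := hgrowth t ht x hx
    have h2 : Real.exp (-(l * (t - a))) ≤ 1 := by
      rw [Real.exp_le_one_iff]
      have := mul_nonneg hl (sub_nonneg.2 ht.1)
      linarith
    calc G (t, x) ≤ (N * (L + x) ^ q) * 1 * (L + x) ^ (-p) := by
          simp only [hG]
          gcongr
          exact (abs_nonneg _).trans h1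
      _ = N * (L + x) ^ (-(p - q)) := by
          rw [mul_one, mul_assoc, ← Real.rpow_add hLx]; congr 2; ring
  have hlim : Tendsto (fun x : ℝ => N * (L + x) ^ (-(p - q))) atTop (𝓝 (N * 0)) := by
    refine Tendsto.const_mul _ ?_
    exact (tendsto_rpow_neg_atTop (sub_pos.2 hqp)).comp (tendsto_atTop_add_const_left _ _ tendsto_id)
  rw [mul_zero] at hlim
  obtain ⟨X, hX⟩ := eventually_atTop.1 (hlim.eventually (gt_mem_nhds hpos))
  set Y := max X x₁
  have hcomp : IsCompact (Icc a c ×ˢ Icc 0 Y) := isCompact_Icc.prod isCompact_Icc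
  obtain ⟨z, hz, hmax⟩ := hcomp.exists_isMaxOn ⟨(t₁, x₁), ht₁, hx₁, le_max_right _ _⟩
    (hGc.mono (prod_mono_right fun x hx => hx.1))
  refine ⟨z.1, hz.1, z.2, hz.2.1, fun t ht x hx => ?_⟩
  rcases le_or_gt x Y with hxY | hxY
  · exact hmax (show (t, x) ∈ Icc a c ×ˢ Icc 0 Y from ⟨ht, hx, hxY⟩)
  · have h1 : G (t₁, x₁) ≤ G z :=
      hmax (show (t₁, x₁) ∈ Icc a c ×ˢ Icc 0 Y from ⟨ht₁, hx₁, le_max_right _ _⟩)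
    exact (((hdecay t ht x hx).trans_lt (hX x ((le_max_left _ _).trans hxY.le))).trans_le h1).le

/-- If the bound fails, the maximum of the weighted `|φ|` exceeds `N₀`, hence sits at some `t₀ > a`,
`x₀ > 0`. There the first-order conditions fix `φx` and force `|φ|` to grow at rate at least `l`,
whereas the equation allows at most `p B + R`. -/
theorem weighted_bound_of_transport_aux {φ φt φx b r : ℝ → ℝ → ℝ} {a c L q p N N₀ B R l : ℝ}
    (hL : 1 ≤ L) (hqp : q < p) (hp : 0 ≤ p) (hB : 0 ≤ B) (hR : 0 ≤ R)
    (hcont : ContinuousOn (fun z : ℝ × ℝ => φ z.1 z.2) (Icc a c ×ˢ Ici 0))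
    (hzero : ∀ t ∈ Icc a c, φ t 0 = 0)
    (hgrowth : ∀ t ∈ Icc a c, ∀ x, 0 ≤ x → |φ t x| ≤ N * (L + x) ^ q)
    (ht : ∀ t ∈ Icc a c, ∀ x, 0 < x →
      HasDerivWithinAt (fun s => φ s x) (φt t x) (Icc a c) t)
    (hx : ∀ t ∈ Icc a c, ∀ x, 0 < x → HasDerivAt (φ t) (φx t x) x)
    (heq : ∀ t ∈ Icc a c, ∀ x, 0 < x → φt t x = -(b t x * φx t x) + r t x)
    (hb : ∀ t ∈ Icc a c, ∀ x, 0 < x → |b t x| ≤ B * (L + x))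
    (hr : ∀ t ∈ Icc a c, ∀ K, (∀ y, 0 ≤ y → |φ t y| ≤ K * (L + y) ^ p) →
      ∀ x, 0 < x → |r t x| ≤ R * K * (L + x) ^ p)
    (hN₀ : ∀ x, 0 ≤ x → |φ a x| ≤ N₀ * (L + x) ^ p) (hl : p * B + R < l) :
    ∀ t ∈ Icc a c, ∀ x, 0 ≤ x → |φ t x| ≤ N₀ * Real.exp (l * (t - a)) * (L + x) ^ p := by
  have hpB : 0 ≤ p * B := mul_nonneg hp hB
  have hN₀' : 0 ≤ N₀ := by
    have h := (abs_nonneg _).trans (hN₀ 0 le_rfl)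
    have : 0 < (L + 0) ^ p := by positivity
    exact nonneg_of_mul_nonneg_left h this
  by_contra! hcon
  obtain ⟨t₁, ht₁, x₁, hx₁, hlt⟩ := hcon
  have hne : φ t₁ x₁ ≠ 0 := by
    intro h
    rw [h, abs_zero] at hlt
    have : 0 ≤ L + x₁ := by linarith
    exact absurd hlt (not_lt.2 (by positivity))
  obtain ⟨t₀, ht₀, x₀, hx₀, hmax⟩ := exists_forall_weighted_le_of_growth hL hqp hcont hgrowth
    (l := l) (by linarith) ht₁ hx₁ hne
  set m := |φ t₀ x₀| * Real.exp (-(l * (t₀ - a))) * (L + x₀) ^ (-p) with hm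
  have hkey : ∀ t x : ℝ, 0 ≤ x → (|φ t x| =
      |φ t x| * Real.exp (-(l * (t - a))) * (L + x) ^ (-p) *
        (Real.exp (l * (t - a)) * (L + x) ^ p)) := by
    intro t x hx
    have hLx : 0 < L + x := by linarith
    have h1 : Real.exp (-(l * (t - a))) * Real.exp (l * (t - a)) = 1 := by
      rw [← Real.exp_add]; simp
    have h2 : (L + x) ^ (-p) * (L + x) ^ p = 1 := by
      rw [← Real.rpow_add hLx]; simp
    linear_combination (-|φ t x|) * h1 -
      |φ t x| * (Real.exp (-(l * (t - a))) * Real.exp (l * (t - a))) * h2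
  have hbound : ∀ t ∈ Icc a c, ∀ x, 0 ≤ x →
      |φ t x| ≤ m * (Real.exp (l * (t - a)) * (L + x) ^ p) := by
    intro t ht x hx
    have hLx : 0 < L + x := by linarith
    rw [hkey t x hx]
    gcongr
    exact hmax t ht x hx
  have hattain : |φ t₀ x₀| = m * (Real.exp (l * (t₀ - a)) * (L + x₀) ^ p) := hkey t₀ x₀ hx₀
  have hmN : N₀ < m := by
    have h1 := hbound t₁ ht₁ x₁ hx₁
    have hLx : 0 < L + x₁ := by linarith
    rw [mul_assoc] at hlt
    exact lt_of_mul_lt_mul_right (hlt.trans_le h1) (by positivity)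
  have hm0 : 0 < m := hN₀'.trans_lt hmN
  have hLx₀ : 0 < L + x₀ := by linarith
  have hφ0 : φ t₀ x₀ ≠ 0 := by
    rw [← abs_pos, hattain]; positivity
  have hx₀' : 0 < x₀ := by
    rcases hx₀.eq_or_lt with h | h
    · exact absurd (h ▸ hzero t₀ ht₀) hφ0
    · exact h
  have ht₀' : a < t₀ := by
    rcases ht₀.1.eq_or_lt with h | h
    · exfalso
      have h1 := hN₀ x₀ hx₀
      rw [h, hattain, ← h, sub_self, mul_zero, Real.exp_zero, one_mul] at h1
      exact absurd (le_of_mul_le_mul_right h1 (by positivity)) (not_le.2 hmN)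
    · exact h
  -- `σ` is the sign of `φ t₀ x₀`: the differentiable function `σ φ` lies below `|φ|` and touches it
  -- at the maximum.
  obtain ⟨σ, hσ1, hσ⟩ : ∃ σ : ℝ, |σ| = 1 ∧ |φ t₀ x₀| = σ * φ t₀ x₀ := by
    rcases abs_choice (φ t₀ x₀) with h | h
    · exact ⟨1, by simp, by rw [h]; ring⟩
    · exact ⟨-1, by simp, by rw [h]; ring⟩
  have hσle : ∀ t x, σ * φ t x ≤ |φ t x| := fun t x =>
    (le_abs_self _).trans_eq (by rw [abs_mul, hσ1, one_mul])
  set W := m * Real.exp (l * (t₀ - a)) with hW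
  have hW0 : 0 < W := by positivity
  have hdx : σ * φx t₀ x₀ = W * (p * (L + x₀) ^ (p - 1)) := by
    have hd : HasDerivAt (fun x => σ * φ t₀ x - W * (L + x) ^ p)
        (σ * φx t₀ x₀ - W * (1 * p * (L + x₀) ^ (p - 1))) x₀ :=
      ((hx t₀ ht₀ x₀ hx₀').const_mul σ).sub
        ((((hasDerivAt_id x₀).const_add L).rpow_const (Or.inl hLx₀.ne')).const_mul W)
    have hloc : IsLocalMax (fun x => σ * φ t₀ x - W * (L + x) ^ p) x₀ := by
      filter_upwards [Ioi_mem_nhds hx₀'] with x hx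
      have h1 := (hσle t₀ x).trans (hbound t₀ ht₀ x (le_of_lt hx))
      rw [← hσ, hattain]
      simp only [hW]
      linarith
    have := hloc.hasDerivAt_eq_zero hd
    linarith
  have hdt : W * l * (L + x₀) ^ p ≤ σ * φt t₀ x₀ := by
    have hd : HasDerivWithinAt (fun t => σ * φ t x₀ - m * (Real.exp (l * (t - a)) * (L + x₀) ^ p))
        (σ * φt t₀ x₀ - m * (Real.exp (l * (t₀ - a)) * (l * 1) * (L + x₀) ^ p)) (Icc a c) t₀ :=
      ((ht t₀ ht₀ x₀ hx₀').const_mul σ).sub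
        (((((hasDerivAt_id t₀).sub_const a).const_mul l).exp.mul_const
          ((L + x₀) ^ p)).const_mul m).hasDerivWithinAt
    have := hasDerivWithinAt_nonneg_of_forall_le hd ht₀' ht₀.2 fun s hs => by
      have h1 := (hσle s x₀).trans (hbound s hs x₀ hx₀)
      rw [← hσ, hattain]
      linarith
    simp only [hW]
    linarith
  have hrb : |r t₀ x₀| ≤ R * W * (L + x₀) ^ p :=
    hr t₀ ht₀ W (fun y hy => (hbound t₀ ht₀ y hy).trans_eq (by simp only [hW]; ring)) x₀ hx₀'
  have hbb := hb t₀ ht₀ x₀ hx₀'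
  have hPp : (L + x₀) * (L + x₀) ^ (p - 1) = (L + x₀) ^ p := by
    rw [Real.rpow_sub_one hLx₀.ne', mul_div_cancel₀ _ hLx₀.ne']
  have h1 : σ * φt t₀ x₀ ≤ (p * B + R) * W * (L + x₀) ^ p := by
    have e1 : -(b t₀ x₀ * (σ * φx t₀ x₀)) ≤ B * (L + x₀) * (W * (p * (L + x₀) ^ (p - 1))) := by
      rw [hdx, ← neg_mul]
      gcongr
      exact (neg_le_abs _).trans hbb
    have e2 : σ * r t₀ x₀ ≤ R * W * (L + x₀) ^ p :=
      ((le_abs_self _).trans_eq (by rw [abs_mul, hσ1, one_mul])).trans hrb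
    calc σ * φt t₀ x₀ = -(b t₀ x₀ * (σ * φx t₀ x₀)) + σ * r t₀ x₀ := by
          rw [heq t₀ ht₀ x₀ hx₀']; ring
      _ ≤ B * (L + x₀) * (W * (p * (L + x₀) ^ (p - 1))) + R * W * (L + x₀) ^ p := by linarith
      _ = B * W * p * ((L + x₀) * (L + x₀) ^ (p - 1)) + R * W * (L + x₀) ^ p := by ring
      _ = _ := by rw [hPp]; ring
  have h2 : (p * B + R) * W * (L + x₀) ^ p < W * l * (L + x₀) ^ p := by
    have : 0 < W * (L + x₀) ^ p := by positivity
    nlinarith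
  linarith

/-- Solutions of `φ_t + b φ_x = r` with `b` of linear growth and `r` controlled by the weighted
norm of `φ`: the weighted sup norm grows at most exponentially. -/
theorem weighted_bound_of_transport {φ φt φx b r : ℝ → ℝ → ℝ} {a c L q p N N₀ B R : ℝ}
    (hL : 1 ≤ L) (hqp : q < p) (hp : 0 ≤ p) (hB : 0 ≤ B) (hR : 0 ≤ R)
    (hcont : ContinuousOn (fun z : ℝ × ℝ => φ z.1 z.2) (Icc a c ×ˢ Ici 0))
    (hzero : ∀ t ∈ Icc a c, φ t 0 = 0)
    (hgrowth : ∀ t ∈ Icc a c, ∀ x, 0 ≤ x → |φ t x| ≤ N * (L + x) ^ q)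
    (ht : ∀ t ∈ Icc a c, ∀ x, 0 < x →
      HasDerivWithinAt (fun s => φ s x) (φt t x) (Icc a c) t)
    (hx : ∀ t ∈ Icc a c, ∀ x, 0 < x → HasDerivAt (φ t) (φx t x) x)
    (heq : ∀ t ∈ Icc a c, ∀ x, 0 < x → φt t x = -(b t x * φx t x) + r t x)
    (hb : ∀ t ∈ Icc a c, ∀ x, 0 < x → |b t x| ≤ B * (L + x))
    (hr : ∀ t ∈ Icc a c, ∀ K, (∀ y, 0 ≤ y → |φ t y| ≤ K * (L + y) ^ p) →
      ∀ x, 0 < x → |r t x| ≤ R * K * (L + x) ^ p)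
    (hN₀ : ∀ x, 0 ≤ x → |φ a x| ≤ N₀ * (L + x) ^ p) :
    ∀ t ∈ Icc a c, ∀ x, 0 ≤ x →
      |φ t x| ≤ N₀ * Real.exp ((p * B + R) * (t - a)) * (L + x) ^ p := by
  intro t ht' x hx'
  -- The rate was strict; let `l` decrease to `p B + R`.
  have hc : Tendsto (fun l => N₀ * Real.exp (l * (t - a)) * (L + x) ^ p) (𝓝[>] (p * B + R))
      (𝓝 (N₀ * Real.exp ((p * B + R) * (t - a)) * (L + x) ^ p)) :=
    (Continuous.tendsto (by fun_prop) _).mono_left nhdsWithin_le_nhds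
  refine ge_of_tendsto hc ?_
  filter_upwards [self_mem_nhdsWithin] with l hl
  exact weighted_bound_of_transport_aux hL hqp hp hB hR hcont hzero hgrowth ht hx heq hb hr hN₀
    hl t ht' x hx'

/-- Without a source term the bound also holds for the growth exponent itself. -/
theorem weighted_bound_of_homogeneous_transport {φ φt φx b : ℝ → ℝ → ℝ} {a c L q N N₀ B : ℝ}
    (hL : 1 ≤ L) (hq : 0 ≤ q) (hB : 0 ≤ B)
    (hcont : ContinuousOn (fun z : ℝ × ℝ => φ z.1 z.2) (Icc a c ×ˢ Ici 0))
    (hzero : ∀ t ∈ Icc a c, φ t 0 = 0)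
    (hgrowth : ∀ t ∈ Icc a c, ∀ x, 0 ≤ x → |φ t x| ≤ N * (L + x) ^ q)
    (ht : ∀ t ∈ Icc a c, ∀ x, 0 < x →
      HasDerivWithinAt (fun s => φ s x) (φt t x) (Icc a c) t)
    (hx : ∀ t ∈ Icc a c, ∀ x, 0 < x → HasDerivAt (φ t) (φx t x) x)
    (heq : ∀ t ∈ Icc a c, ∀ x, 0 < x → φt t x = -(b t x * φx t x))
    (hb : ∀ t ∈ Icc a c, ∀ x, 0 < x → |b t x| ≤ B * (L + x))
    (hN₀ : ∀ x, 0 ≤ x → |φ a x| ≤ N₀ * (L + x) ^ q) :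
    ∀ t ∈ Icc a c, ∀ x, 0 ≤ x →
      |φ t x| ≤ N₀ * Real.exp (q * B * (t - a)) * (L + x) ^ q := by
  intro t ht' x hx'
  have hN₀' : 0 ≤ N₀ := by
    have h := (abs_nonneg _).trans (hN₀ 0 le_rfl)
    have : 0 < (L + 0) ^ q := by positivity
    exact nonneg_of_mul_nonneg_left h this
  have hLx : 0 < L + x := by linarith
  -- The maximum is attained only for a weight exponent `p > q`; let `p` decrease to `q`.
  have hc : Tendsto (fun p => N₀ * Real.exp (p * B * (t - a)) * (L + x) ^ p) (𝓝[>] q)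
      (𝓝 (N₀ * Real.exp (q * B * (t - a)) * (L + x) ^ q)) := by
    refine Tendsto.mono_left ?_ nhdsWithin_le_nhds
    refine Continuous.tendsto (Continuous.mul (by fun_prop) ?_) _
    exact continuous_const.rpow continuous_id fun _ => Or.inl hLx.ne'
  refine ge_of_tendsto hc ?_
  filter_upwards [self_mem_nhdsWithin] with p hp
  have hp : q < p := hp
  have := weighted_bound_of_transport (r := fun _ _ => 0) (R := 0) (p := p) hL hp
    (hq.trans hp.le) hB le_rfl hcont hzero
    hgrowth ht hx (fun t ht x hx => by rw [heq t ht x hx, add_zero]) hb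
    (fun _ _ _ _ _ _ => by simp) (N₀ := N₀)
    (fun x hx => (hN₀ x hx).trans (by gcongr; linarith)) t ht' x hx'
  simpa using this

/-! ### A Baire category argument for uniform bounds -/

theorem exists_subset_of_forall_mem_nhdsWithin {E : ℕ → Set ℝ} (hmono : Monotone E) {K : Set ℝ}
    (hK : IsCompact K) (h : ∀ t ∈ K, ∃ m, E m ∈ 𝓝[K] t) : ∃ m, K ⊆ E m := by
  refine hK.induction_on (p := fun s => ∃ m, s ⊆ E m) ⟨0, empty_subset _⟩
    (fun s t hst ⟨m, hm⟩ => ⟨m, hst.trans hm⟩) ?_ ?_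
  · rintro s t ⟨m, hm⟩ ⟨n, hn⟩
    exact ⟨max m n, union_subset (hm.trans (hmono (le_max_left _ _)))
      (hn.trans (hmono (le_max_right _ _)))⟩
  · intro t ht
    obtain ⟨m, hm⟩ := h t ht
    exact ⟨E m, hm, m, Subset.rfl⟩

/-- If `E` is an increasing closed cover of `[0, T]` such that every interval contained in some
`E m` is contained in `E (F n)` as soon as one of its endpoints is in `E n`, then `[0, T]` is
contained in some `E m`. -/
theorem exists_Icc_subset_of_endpoint_control {T : ℝ} {E : ℕ → Set ℝ} {F : ℕ → ℕ}
    (hmono : Monotone E) (hclosed : ∀ n, IsClosed (E n ∩ Icc 0 T))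
    (hcover : ∀ t ∈ Icc 0 T, ∃ n, t ∈ E n)
    (hF : ∀ a c n m, 0 ≤ a → a ≤ c → c ≤ T → Icc a c ⊆ E m → (a ∈ E n ∨ c ∈ E n) →
      Icc a c ⊆ E (F n)) :
    ∃ m, Icc 0 T ⊆ E m := by
  by_contra hcon
  -- The bad times, near which no single `E m` suffices. Without bad times compactness concludes;
  -- otherwise Baire applies to the closed set `B`.
  set B : Set ℝ := {t ∈ Icc 0 T | ∀ m, E m ∉ 𝓝[Icc 0 T] t} with hB
  have hBne : B.Nonempty := by
    by_contra hne
    rw [not_nonempty_iff_eq_empty] at hne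
    refine hcon (exists_subset_of_forall_mem_nhdsWithin hmono isCompact_Icc fun t ht => ?_)
    by_contra! h
    exact (hne ▸ (⟨ht, h⟩ : t ∈ B) : t ∈ (∅ : Set ℝ))
  have hBclosed : IsClosed B := by
    refine isClosed_of_closure_subset fun t ht => ?_
    have htI : t ∈ Icc 0 T :=
      isClosed_Icc.closure_subset_iff.2 (fun s (hs : s ∈ B) => hs.1) ht
    refine ⟨htI, fun m hm => ?_⟩
    obtain ⟨U, hUo, htU, hU⟩ := mem_nhdsWithin.1 hm
    obtain ⟨s, hsU, hsB⟩ := mem_closure_iff.1 ht U hUo htU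
    exact hsB.2 m (mem_nhdsWithin.2 ⟨U, hUo, hsU, hU⟩)
  have hgood : ∀ a c, 0 ≤ a → a ≤ c → c ≤ T → (∀ s ∈ Icc a c, s ∉ B) → ∃ m, Icc a c ⊆ E m := by
    intro a c ha hac hc hs
    refine exists_subset_of_forall_mem_nhdsWithin hmono isCompact_Icc fun t ht => ?_
    have htI : t ∈ Icc 0 T := ⟨ha.trans ht.1, ht.2.trans hc⟩
    by_contra! h
    exact hs t ht ⟨htI, fun m hm => h m (nhdsWithin_mono _ (Icc_subset_Icc ha hc) hm)⟩
  have hEclosed : ∀ a c n, 0 ≤ a → c ≤ T → IsClosed (E n ∩ Icc a c) := by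
    intro a c n ha hc
    have : E n ∩ Icc a c = (E n ∩ Icc 0 T) ∩ Icc a c := by
      rw [inter_assoc, inter_eq_self_of_subset_right (Icc_subset_Icc ha hc)]
    rw [this]
    exact (hclosed n).inter isClosed_Icc
  have : CompleteSpace B := hBclosed.completeSpace_coe
  have : Nonempty B := hBne.to_subtype
  obtain ⟨n, ⟨t, htB⟩, htn⟩ := nonempty_interior_of_iUnion_of_closed
    (f := fun n => ((↑) : B → ℝ) ⁻¹' (E n ∩ Icc 0 T))
    (fun n => (hclosed n).preimage continuous_subtype_val)
    (by
      refine eq_univ_of_forall fun t => ?_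
      obtain ⟨n, hn⟩ := hcover t t.2.1
      exact mem_iUnion.2 ⟨n, hn, t.2.1⟩)
  obtain ⟨ε, hε, hball⟩ := Metric.mem_nhds_iff.1 (mem_interior_iff_mem_nhds.1 htn)
  have hBn : ∀ s ∈ B, |s - t| < ε → s ∈ E n := fun s hs hst =>
    (hball (show (⟨s, hs⟩ : B) ∈ Metric.ball ⟨t, htB⟩ ε by
      simpa [Metric.mem_ball, Subtype.dist_eq, Real.dist_eq] using hst)).1
  refine htB.2 (max n (F n)) (mem_nhdsWithin.2
    ⟨Metric.ball t ε, Metric.isOpen_ball, Metric.mem_ball_self hε, ?_⟩)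
  rintro s ⟨hst, hsI⟩
  rw [Metric.mem_ball, Real.dist_eq] at hst
  by_cases hsB : s ∈ B
  · exact hmono (le_max_left _ _) (hBn s hsB hst)
  refine hmono (le_max_right n (F n)) ?_
  -- `s` lies in a gap of `B`; let `b` be the first point of `B` met from `s` towards `t`. Segments
  -- from `s` stopping short of `b` lie in some `E m`, hence in `E (F k)` independently of their
  -- length. Closedness adds `b`, and since `b ∈ E n`, endpoint control replaces `k` by `n`.
  obtain ⟨k, hk⟩ := hcover s hsI
  rcases lt_trichotomy s t with hlt | rfl | hlt
  · have hne : (B ∩ Icc s t).Nonempty := ⟨t, htB, hlt.le, le_rfl⟩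
    have hcl : IsClosed (B ∩ Icc s t) := hBclosed.inter isClosed_Icc
    have hbdd : BddBelow (B ∩ Icc s t) := ⟨s, fun r hr => hr.2.1⟩
    obtain ⟨hbB, hsb, hbt⟩ := hcl.csInf_mem hne hbdd
    set b := sInf (B ∩ Icc s t)
    have hsb' : s < b := lt_of_le_of_ne hsb fun h => hsB (h ▸ hbB)
    have hbn : b ∈ E n := hBn b hbB (by
      rw [abs_sub_lt_iff] at hst ⊢; constructor <;> linarith)
    have hsub : Ico s b ⊆ E (F k) ∩ Icc s b := by
      intro d hd
      obtain ⟨m, hm⟩ := hgood s d hsI.1 hd.1 (hd.2.le.trans hbB.1.2) fun r hr hrB =>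
        absurd (csInf_le hbdd ⟨hrB, hr.1, by linarith [hr.2, hd.2]⟩)
          (not_le.2 (hr.2.trans_lt hd.2))
      exact ⟨hF s d k m hsI.1 hd.1 (hd.2.le.trans hbB.1.2) hm (Or.inl hk) ⟨hd.1, le_rfl⟩,
        hd.1, hd.2.le⟩
    have hsub' : Icc s b ⊆ E (F k) := by
      rw [← closure_Ico hsb'.ne]
      exact ((hEclosed s b (F k) hsI.1 hbB.1.2).closure_subset_iff.2 hsub).trans inter_subset_left
    exact hF s b n _ hsI.1 hsb hbB.1.2 hsub' (Or.inr hbn) ⟨le_rfl, hsb⟩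
  · exact absurd htB hsB
  · have hne : (B ∩ Icc t s).Nonempty := ⟨t, htB, le_rfl, hlt.le⟩
    have hcl : IsClosed (B ∩ Icc t s) := hBclosed.inter isClosed_Icc
    have hbdd : BddAbove (B ∩ Icc t s) := ⟨s, fun r hr => hr.2.2⟩
    obtain ⟨hbB, htb, hbs⟩ := hcl.csSup_mem hne hbdd
    set b := sSup (B ∩ Icc t s)
    have hbs' : b < s := lt_of_le_of_ne hbs fun h => hsB (h ▸ hbB)
    have hbn : b ∈ E n := hBn b hbB (by
      rw [abs_sub_lt_iff] at hst ⊢; constructor <;> linarith)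
    have hsub : Ioc b s ⊆ E (F k) ∩ Icc b s := by
      intro d hd
      obtain ⟨m, hm⟩ := hgood d s (hbB.1.1.trans hd.1.le) hd.2 hsI.2 fun r hr hrB =>
        absurd (le_csSup hbdd ⟨hrB, by linarith [hr.1, hd.1], hr.2⟩)
          (not_le.2 (hd.1.trans_le hr.1))
      exact ⟨hF d s k m (hbB.1.1.trans hd.1.le) hd.2 hsI.2 hm (Or.inr hk) ⟨le_rfl, hd.2⟩,
        hd.1.le, hd.2⟩
    have hsub' : Icc b s ⊆ E (F k) := by
      rw [← closure_Ioc hbs'.ne]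
      exact ((hEclosed b s (F k) hbB.1.1 hsI.2).closure_subset_iff.2 hsub).trans inter_subset_left
    exact hF b s n _ hbB.1.1 hbs hsI.2 hsub' (Or.inl hbn) ⟨hbs, le_rfl⟩

/-! ### Bounds for the velocity -/

theorem kernel_eq (γ x y : ℝ) : kernel γ x y = |y - x| ^ (-γ) - |x + y| ^ (-γ) := by
  simp only [kernel, Real.rpow_neg (abs_nonneg _), one_div]

theorem intervalIntegrable_abs_rpow_neg {γ : ℝ} (hγ : γ < 1) (a b : ℝ) :
    IntervalIntegrable (fun s : ℝ => |s| ^ (-γ)) volume a b := by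
  have h1 : ∀ c : ℝ, 0 ≤ c → IntervalIntegrable (fun s : ℝ => |s| ^ (-γ)) volume 0 c := by
    intro c hc
    refine (intervalIntegral.intervalIntegrable_rpow' (a := 0) (b := c)
      (by linarith : -1 < -γ)).congr ?_
    intro s hs
    rw [uIoc_of_le hc] at hs
    simp only [abs_of_pos hs.1]
  have h2 : ∀ c : ℝ, IntervalIntegrable (fun s : ℝ => |s| ^ (-γ)) volume 0 c := by
    intro c
    rcases le_total 0 c with hc | hc
    · exact h1 c hc
    · rw [IntervalIntegrable.iff_comp_neg]
      simpa using h1 (-c) (by linarith)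
  exact (h2 a).symm.trans (h2 b)

/-- The odd primitive of `|·|^{-γ}`. -/
def kernelPrimitive (γ z : ℝ) : ℝ := ∫ s in (0 : ℝ)..z, |s| ^ (-γ)

theorem kernelPrimitive_of_nonneg {γ z : ℝ} (hγ : γ < 1) (hz : 0 ≤ z) :
    kernelPrimitive γ z = z ^ (1 - γ) / (1 - γ) := by
  have : kernelPrimitive γ z = ∫ s in (0 : ℝ)..z, s ^ (-γ) := by
    refine intervalIntegral.integral_congr fun s hs => ?_
    rw [uIcc_of_le hz] at hs
    simp only [abs_of_nonneg hs.1]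
  rw [this, integral_rpow (Or.inl (by linarith)), Real.zero_rpow (by linarith), sub_zero,
    neg_add_eq_sub]

theorem kernelPrimitive_neg (γ z : ℝ) : kernelPrimitive γ (-z) = -kernelPrimitive γ z := by
  have h := intervalIntegral.integral_comp_neg (a := 0) (b := z) (fun s : ℝ => |s| ^ (-γ))
  simp only [abs_neg, neg_zero] at h
  rw [kernelPrimitive, kernelPrimitive, h, intervalIntegral.integral_symm]

theorem continuous_kernelPrimitive {γ : ℝ} (hγ : γ < 1) : Continuous (kernelPrimitive γ) :=
  intervalIntegral.continuous_primitive (intervalIntegrable_abs_rpow_neg hγ) 0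

theorem hasDerivAt_kernelPrimitive {γ z : ℝ} (hγ : γ < 1) (hz : z ≠ 0) :
    HasDerivAt (kernelPrimitive γ) (|z| ^ (-γ)) z := by
  refine intervalIntegral.integral_hasDerivAt_right (intervalIntegrable_abs_rpow_neg hγ 0 z) ?_ ?_
  · exact Measurable.stronglyMeasurable (by fun_prop) |>.stronglyMeasurableAtFilter
  · exact (continuous_abs.continuousAt).rpow_const (Or.inl (abs_ne_zero.2 hz))

theorem integral_abs_sub_rpow_neg {γ : ℝ} (hγ : γ < 1) (z a b : ℝ) :
    ∫ s in a..b, |s - z| ^ (-γ) = kernelPrimitive γ (b - z) - kernelPrimitive γ (a - z) := by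
  rw [intervalIntegral.integral_comp_sub_right (fun s : ℝ => |s| ^ (-γ)) z, kernelPrimitive,
    kernelPrimitive, intervalIntegral.integral_interval_sub_left
      (intervalIntegrable_abs_rpow_neg hγ _ _) (intervalIntegrable_abs_rpow_neg hγ _ _)]

theorem intervalIntegrable_abs_sub_rpow_neg {γ : ℝ} (hγ : γ < 1) (z a b : ℝ) :
    IntervalIntegrable (fun s : ℝ => |s - z| ^ (-γ)) volume a b := by
  have := (intervalIntegrable_abs_rpow_neg hγ (a - z) (b - z)).comp_sub_right z
  simpa using this

theorem abs_rpow_neg_sub_rpow_neg_le {γ m a b : ℝ} (hγ : 0 < γ) (hm : 0 < m) (ha : m ≤ a)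
    (hb : m ≤ b) : |a ^ (-γ) - b ^ (-γ)| ≤ γ * m ^ (-γ - 1) * |a - b| := by
  have := (convex_Ici m).norm_image_sub_le_of_norm_hasDerivWithin_le (f := fun x : ℝ => x ^ (-γ))
    (f' := fun x => -γ * x ^ (-γ - 1)) (C := γ * m ^ (-γ - 1)) (x := b) (y := a)
    (fun x hx => (Real.hasDerivAt_rpow_const
      (Or.inl (hm.trans_le hx).ne')).hasDerivWithinAt) ?_ hb ha
  · simpa [Real.norm_eq_abs] using this
  · intro x hx
    have hx0 : 0 < x := hm.trans_le hx
    rw [Real.norm_eq_abs, abs_mul, abs_neg, abs_of_pos hγ,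
      abs_of_pos (Real.rpow_pos_of_pos hx0 _)]
    have := Real.rpow_le_rpow_of_nonpos hm hx (by linarith : -γ - 1 ≤ 0)
    gcongr

theorem abs_kernel_le_near {γ x y : ℝ} (hγ : 0 < γ) (hx : 0 ≤ x) (hy : 0 < y) :
    |kernel γ x y| ≤ |y - x| ^ (-γ) + |y - 0| ^ (-γ) := by
  rw [kernel_eq, sub_zero]
  refine (abs_sub _ _).trans ?_
  rw [abs_of_nonneg (Real.rpow_nonneg (abs_nonneg _) _),
    abs_of_nonneg (Real.rpow_nonneg (abs_nonneg _) _)]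
  refine add_le_add le_rfl ?_
  refine Real.rpow_le_rpow_of_nonpos (abs_pos.2 hy.ne') ?_ (neg_nonpos.2 hγ.le)
  rw [abs_of_pos hy, abs_of_pos (by linarith : 0 < x + y)]
  linarith

/-- Both distances are at least `y / 2` and differ by `2 x`, so the mean value inequality gains a
factor `x / y`, which makes the tail integrable. -/
theorem abs_kernel_le_far {γ x y : ℝ} (hγ : 0 < γ) (hγ1 : γ < 1) (hx : 0 ≤ x) (hy : 0 < y)
    (hxy : 2 * x ≤ y) : |kernel γ x y| ≤ 8 * x * y ^ (-γ - 1) := by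
  rw [kernel_eq, abs_of_nonneg (by linarith : 0 ≤ y - x), abs_of_nonneg (by linarith : 0 ≤ x + y)]
  have h := abs_rpow_neg_sub_rpow_neg_le (a := y - x) (b := x + y) hγ (half_pos hy)
    (by linarith) (by linarith)
  have e1 : |y - x - (x + y)| = 2 * x := by
    rw [show y - x - (x + y) = -(2 * x) by ring, abs_neg, abs_of_nonneg (by linarith)]
  have e2 : (y / 2) ^ (-γ - 1) = 2 ^ (γ + 1) * y ^ (-γ - 1) := by
    rw [Real.div_rpow hy.le (by norm_num), div_eq_mul_inv, ← Real.rpow_neg (by norm_num), mul_comm]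
    congr 2; ring
  have e3 : (2 : ℝ) ^ (γ + 1) ≤ 4 := by
    calc (2 : ℝ) ^ (γ + 1) ≤ 2 ^ (2 : ℝ) :=
          Real.rpow_le_rpow_of_exponent_le (by norm_num) (by linarith)
      _ = 4 := by norm_num
  have hyp : 0 < y ^ (-γ - 1) := Real.rpow_pos_of_pos hy _
  calc |(y - x) ^ (-γ) - (x + y) ^ (-γ)| ≤ γ * (y / 2) ^ (-γ - 1) * |y - x - (x + y)| := h
    _ = γ * 2 ^ (γ + 1) * (2 * x * y ^ (-γ - 1)) := by rw [e1, e2]; ring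
    _ ≤ 1 * 4 * (2 * x * y ^ (-γ - 1)) := by gcongr
    _ = _ := by ring

theorem measurable_kernel (γ x : ℝ) : Measurable (kernel γ x) := by
  unfold kernel; fun_prop

/-! ### Velocity of functions of growth `(L + y) ^ p` with `p < γ` -/

section growth

variable {γ p L N x : ℝ} {f : ℝ → ℝ}

theorem abs_kernel_mul_le_near (hγ : 0 < γ) (hγ1 : γ < 1) (hp : 0 ≤ p) (hpγ : p < γ) (hL : 0 < L)
    (hN : 0 ≤ N) (hf : ∀ y, 0 < y → |f y| ≤ N * (L + y) ^ p) (hx : 0 ≤ x) {y : ℝ}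
    (hy : y ∈ Ioc 0 (2 * (L + x))) :
    ‖kernel γ x y * f y‖ ≤ 3 * N * (L + x) ^ p * (|y - x| ^ (-γ) + |y - 0| ^ (-γ)) := by
  have hS : 0 < L + x := by linarith
  rw [norm_mul, Real.norm_eq_abs, Real.norm_eq_abs]
  have h1 : |f y| ≤ 3 * N * (L + x) ^ p := by
    calc |f y| ≤ N * (L + y) ^ p := hf y hy.1
      _ ≤ N * (3 * (L + x)) ^ p := by
          have := hy.1
          have := hy.2
          gcongr
          linarith
      _ = N * (3 ^ p * (L + x) ^ p) := by rw [Real.mul_rpow (by norm_num) hS.le]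
      _ ≤ N * (3 ^ (1 : ℝ) * (L + x) ^ p) := by
          gcongr
          · norm_num
          · linarith
      _ = _ := by rw [Real.rpow_one]; ring
  rw [mul_comm]
  have h2 := abs_kernel_le_near hγ hx hy.1
  gcongr

theorem abs_kernel_mul_le_far (hγ : 0 < γ) (hγ1 : γ < 1) (hp : 0 ≤ p) (hpγ : p < γ) (hL : 0 < L)
    (hN : 0 ≤ N) (hf : ∀ y, 0 < y → |f y| ≤ N * (L + y) ^ p) (hx : 0 ≤ x) {y : ℝ}
    (hy : y ∈ Ioi (2 * (L + x))) :
    ‖kernel γ x y * f y‖ ≤ 16 * N * x * y ^ (p - γ - 1) := by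
  have hy' : 2 * (L + x) < y := hy
  have hy0 : 0 < y := by linarith
  rw [norm_mul, Real.norm_eq_abs, Real.norm_eq_abs]
  have h1 : |f y| ≤ 2 * N * y ^ p := by
    calc |f y| ≤ N * (L + y) ^ p := hf y hy0
      _ ≤ N * (2 * y) ^ p := by
          gcongr
          linarith
      _ = N * (2 ^ p * y ^ p) := by rw [Real.mul_rpow (by norm_num) hy0.le]
      _ ≤ N * (2 ^ (1 : ℝ) * y ^ p) := by
          gcongr
          · norm_num
          · linarith
      _ = _ := by rw [Real.rpow_one]; ring
  have h2 := abs_kernel_le_far hγ hγ1 hx hy0 (by linarith)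
  calc |kernel γ x y| * |f y| ≤ (8 * x * y ^ (-γ - 1)) * (2 * N * y ^ p) := by gcongr
    _ = 16 * N * x * (y ^ p * y ^ (-γ - 1)) := by ring
    _ = _ := by rw [← Real.rpow_add hy0]; congr 2; ring

theorem integrableOn_near_bound (hγ1 : γ < 1) (x A R : ℝ) (hR : 0 ≤ R) :
    IntegrableOn (fun y => A * (|y - x| ^ (-γ) + |y - 0| ^ (-γ))) (Ioc 0 R) := by
  rw [← intervalIntegrable_iff_integrableOn_Ioc_of_le hR]
  exact ((intervalIntegrable_abs_sub_rpow_neg hγ1 x 0 R).add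
    (intervalIntegrable_abs_sub_rpow_neg hγ1 0 0 R)).const_mul A

theorem integrableOn_kernel_mul (hγ : 0 < γ) (hγ1 : γ < 1) (hp : 0 ≤ p) (hpγ : p < γ) (hL : 0 < L)
    (hN : 0 ≤ N) (hf : ∀ y, 0 < y → |f y| ≤ N * (L + y) ^ p) (hfc : Continuous f) (hx : 0 ≤ x) :
    IntegrableOn (fun y => kernel γ x y * f y) (Ioi 0) := by
  have hS : 0 < 2 * (L + x) := by linarith
  have hmeas : Measurable fun y => kernel γ x y * f y := (measurable_kernel γ x).mul hfc.measurable
  rw [← Ioc_union_Ioi_eq_Ioi hS.le]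
  refine IntegrableOn.union ?_ ?_
  · exact (integrableOn_near_bound hγ1 x (3 * N * (L + x) ^ p) _ hS.le).mono'
      hmeas.aestronglyMeasurable ((ae_restrict_iff' measurableSet_Ioc).2
        (ae_of_all _ fun y hy => abs_kernel_mul_le_near hγ hγ1 hp hpγ hL hN hf hx hy))
  · exact ((integrableOn_Ioi_rpow_of_lt (by linarith : p - γ - 1 < -1) hS).const_mul
        (16 * N * x)).mono'
      hmeas.aestronglyMeasurable ((ae_restrict_iff' measurableSet_Ioi).2
        (ae_of_all _ fun y hy => abs_kernel_mul_le_far hγ hγ1 hp hpγ hL hN hf hx hy))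

/-- The constant in the bound for the velocity. -/
def velocityConst (γ p : ℝ) : ℝ := 18 / (1 - γ) + 16 / (γ - p)

theorem velocityConst_pos (hγ1 : γ < 1) (hpγ : p < γ) : 0 < velocityConst γ p := by
  have h1 : 0 < 1 - γ := by linarith
  have h2 : 0 < γ - p := by linarith
  unfold velocityConst
  positivity

/-- The integral is split at `2 (L + x)`. Below it, `f` is replaced by a constant and three kernel
primitives produce `18 / (1 - γ)`; beyond it, `y ^ (p - γ - 1)` is integrable because `p < γ` and
produces `16 / (γ - p)`. -/
theorem abs_velocity_le (hγ : 0 < γ) (hγ1 : γ < 1) (hp : 0 ≤ p) (hpγ : p < γ) (hL : 0 < L)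
    (hN : 0 ≤ N) (hf : ∀ y, 0 < y → |f y| ≤ N * (L + y) ^ p) (hfc : Continuous f) (hx : 0 ≤ x) :
    |velocity γ f x| ≤ velocityConst γ p * N * (L + x) ^ (1 - γ + p) := by
  have hS : 0 < L + x := by linarith
  have h1γ : 0 < 1 - γ := by linarith
  have hγp : 0 < γ - p := by linarith
  have hKint := integrableOn_kernel_mul hγ hγ1 hp hpγ hL hN hf hfc hx
  set R := 2 * (L + x) with hR
  have hR0 : 0 < R := by linarith
  rw [velocity, abs_neg, ← Ioc_union_Ioi_eq_Ioi hR0.le, setIntegral_union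
    (Ioc_disjoint_Ioi le_rfl) measurableSet_Ioi (hKint.mono_set Ioc_subset_Ioi_self)
    (hKint.mono_set (Ioi_subset_Ioi hR0.le))]
  have hprim : ∀ z, 0 ≤ z → z ≤ R →
      kernelPrimitive γ z ≤ 2 * (L + x) ^ (1 - γ) / (1 - γ) := by
    intro z hz hzR
    rw [kernelPrimitive_of_nonneg hγ1 hz]
    gcongr
    calc z ^ (1 - γ) ≤ (2 * (L + x)) ^ (1 - γ) := by gcongr
      _ = 2 ^ (1 - γ) * (L + x) ^ (1 - γ) := Real.mul_rpow (by norm_num) hS.le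
      _ ≤ 2 ^ (1 : ℝ) * (L + x) ^ (1 - γ) := by
          gcongr
          · norm_num
          · linarith
      _ = _ := by rw [Real.rpow_one]
  have b1 : ‖∫ y in Ioc 0 R, kernel γ x y * f y‖ ≤
      3 * N * (L + x) ^ p * (3 * (2 * (L + x) ^ (1 - γ) / (1 - γ))) := by
    refine (norm_integral_le_of_norm_le (integrableOn_near_bound hγ1 x _ _ hR0.le)
      ((ae_restrict_iff' measurableSet_Ioc).2 (ae_of_all _ fun y hy =>
        abs_kernel_mul_le_near hγ hγ1 hp hpγ hL hN hf hx hy))).trans ?_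
    rw [← intervalIntegral.integral_of_le hR0.le, intervalIntegral.integral_const_mul,
      intervalIntegral.integral_add (intervalIntegrable_abs_sub_rpow_neg hγ1 x 0 R)
        (intervalIntegrable_abs_sub_rpow_neg hγ1 0 0 R), integral_abs_sub_rpow_neg hγ1,
      integral_abs_sub_rpow_neg hγ1, zero_sub, kernelPrimitive_neg]
    have e1 := hprim (R - x) (by linarith) (by linarith)
    have e2 := hprim x hx (by linarith)
    have e3 := hprim R hR0.le le_rfl
    have e4 : kernelPrimitive γ (0 - 0) = 0 := by simp [kernelPrimitive]
    rw [e4, sub_zero, sub_zero]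
    gcongr
    linarith
  have b2 : ‖∫ y in Ioi R, kernel γ x y * f y‖ ≤
      16 * N * x * ((L + x) ^ (p - γ) / (γ - p)) := by
    refine (norm_integral_le_of_norm_le
      ((integrableOn_Ioi_rpow_of_lt (by linarith : p - γ - 1 < -1) hR0).const_mul (16 * N * x))
      ((ae_restrict_iff' measurableSet_Ioi).2 (ae_of_all _ fun y hy =>
        abs_kernel_mul_le_far hγ hγ1 hp hpγ hL hN hf hx hy))).trans ?_
    rw [integral_const_mul, integral_Ioi_rpow_of_lt (by linarith) hR0]
    have : -R ^ (p - γ - 1 + 1) / (p - γ - 1 + 1) = R ^ (p - γ) / (γ - p) := by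
      rw [sub_add_cancel, ← neg_sub γ p, div_neg, neg_div, neg_neg]
    rw [this]
    have : R ^ (p - γ) ≤ (L + x) ^ (p - γ) :=
      Real.rpow_le_rpow_of_nonpos hS (by linarith) (by linarith)
    gcongr
  have c1 : (L + x) ^ p * (L + x) ^ (1 - γ) = (L + x) ^ (1 - γ + p) := by
    rw [← Real.rpow_add hS]; congr 1; ring
  have c2 : (L + x) * (L + x) ^ (p - γ) = (L + x) ^ (1 - γ + p) := by
    nth_rewrite 1 [← Real.rpow_one (L + x)]
    rw [← Real.rpow_add hS]; congr 1; ring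
  calc |(∫ y in Ioc 0 R, kernel γ x y * f y) + ∫ y in Ioi R, kernel γ x y * f y|
      ≤ 3 * N * (L + x) ^ p * (3 * (2 * (L + x) ^ (1 - γ) / (1 - γ))) +
        16 * N * x * ((L + x) ^ (p - γ) / (γ - p)) := (abs_add_le _ _).trans (add_le_add b1 b2)
    _ ≤ 3 * N * (L + x) ^ p * (3 * (2 * (L + x) ^ (1 - γ) / (1 - γ))) +
        16 * N * (L + x) * ((L + x) ^ (p - γ) / (γ - p)) := by
          gcongr
          linarith
    _ = 18 / (1 - γ) * N * ((L + x) ^ p * (L + x) ^ (1 - γ)) +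
        16 / (γ - p) * N * ((L + x) * (L + x) ^ (p - γ)) := by ring
    _ = _ := by rw [c1, c2, velocityConst]; ring

/-- The point is the factor `L ^ (p - γ)`: shifting the weight far enough makes the transport rate
as small as desired. -/
theorem abs_velocity_le_linear (hγ : 0 < γ) (hγ1 : γ < 1) (hp : 0 ≤ p) (hpγ : p < γ) (hL : 0 < L)
    (hN : 0 ≤ N) (hf : ∀ y, 0 < y → |f y| ≤ N * (L + y) ^ p) (hfc : Continuous f) (hx : 0 ≤ x) :
    |velocity γ f x| ≤ velocityConst γ p * N * L ^ (p - γ) * (L + x) := by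
  have hS : 0 < L + x := by linarith
  have hC := velocityConst_pos hγ1 hpγ
  refine (abs_velocity_le hγ hγ1 hp hpγ hL hN hf hfc hx).trans ?_
  have c2 : (L + x) ^ (1 - γ + p) = (L + x) ^ (p - γ) * (L + x) := by
    rw [show 1 - γ + p = p - γ + 1 by ring, Real.rpow_add_one hS.ne']
  rw [c2, ← mul_assoc]
  have : (L + x) ^ (p - γ) ≤ L ^ (p - γ) :=
    Real.rpow_le_rpow_of_nonpos hL (by linarith) (by linarith)
  gcongr

theorem velocity_sub {f g : ℝ → ℝ} (hf : IntegrableOn (fun y => kernel γ x y * f y) (Ioi 0))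
    (hg : IntegrableOn (fun y => kernel γ x y * g y) (Ioi 0)) :
    velocity γ (fun y => f y - g y) x = velocity γ f x - velocity γ g x := by
  simp only [velocity, mul_sub]
  rw [integral_sub hf hg]
  ring

end growth

/-! ### Uniqueness -/

theorem exists_bound_of_weightedNorm_lt_top {s : ℝ} {f : ℝ → ℝ} (h : weightedNorm s f < ∞) :
    ∃ N : ℝ, 0 ≤ N ∧ ∀ x, 0 ≤ x → |f x| ≤ N * (1 + x) ^ s := by
  refine ⟨(weightedNorm s f).toReal, ENNReal.toReal_nonneg, fun x hx => ?_⟩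
  have h1 : ENNReal.ofReal (|f x| * (1 + x) ^ (-s)) ≤ weightedNorm s f :=
    le_iSup₂ (f := fun (x : ℝ) (_ : 0 ≤ x) => ENNReal.ofReal (|f x| * (1 + x) ^ (-s))) x hx
  have h2 := (ENNReal.ofReal_le_iff_le_toReal h.ne).1 h1
  have hx1 : 0 < 1 + x := by linarith
  rwa [Real.rpow_neg hx1.le, ← div_eq_mul_inv, div_le_iff₀ (Real.rpow_pos_of_pos hx1 _)] at h2

theorem weightedNorm_lt_top_of_bound {s N : ℝ} {f : ℝ → ℝ}
    (h : ∀ x, 0 ≤ x → |f x| ≤ N * (1 + x) ^ s) : weightedNorm s f < ∞ := by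
  refine lt_of_le_of_lt (iSup₂_le fun x hx => ENNReal.ofReal_le_ofReal ?_)
    (ENNReal.ofReal_lt_top (r := N))
  have hx1 : 0 < 1 + x := by linarith
  rw [Real.rpow_neg hx1.le, ← div_eq_mul_inv, div_le_iff₀ (Real.rpow_pos_of_pos hx1 _)]
  exact h x hx

/-- A priori bound, in the norm with weight `(L + x)^{-q}` for large `L`, for solutions of the
equation run forwards (`σ = 1`) or backwards (`σ = -1`) in time. -/
theorem weighted_bound_of_nonlinear_transport {γ q σ : ℝ} (hq : 0 < q) (hqγ : q < γ) (hγ1 : γ < 1)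
    (hσ : |σ| = 1) {φ φt φx : ℝ → ℝ → ℝ} {a c T L N N₀ : ℝ} (hT : c - a ≤ T) (hL : 1 ≤ L)
    (hN : 0 ≤ N) (hN₀ : 0 < N₀)
    (hcont : ContinuousOn (fun z : ℝ × ℝ => φ z.1 z.2) (Icc a c ×ˢ Ici 0))
    (hcontx : ∀ t ∈ Icc a c, Continuous (φ t))
    (hzero : ∀ t ∈ Icc a c, φ t 0 = 0)
    (hgrowth : ∀ t ∈ Icc a c, ∀ x, 0 ≤ x → |φ t x| ≤ N * (1 + x) ^ q)
    (ht : ∀ t ∈ Icc a c, ∀ x, 0 < x →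
      HasDerivWithinAt (fun s => φ s x) (φt t x) (Icc a c) t)
    (hx : ∀ t ∈ Icc a c, ∀ x, 0 < x → HasDerivAt (φ t) (φx t x) x)
    (heq : ∀ t ∈ Icc a c, ∀ x, 0 < x → φt t x = -(σ * velocity γ (φ t) x * φx t x))
    (hinit : ∀ x, 0 ≤ x → |φ a x| ≤ N₀ * (1 + x) ^ q)
    (hLarge : q * (velocityConst γ q * (2 * N₀) * L ^ (q - γ)) * T ≤ Real.log (3 / 2)) :
    ∀ t ∈ Icc a c, ∀ x, 0 ≤ x → |φ t x| ≤ 2 * N₀ * (L + x) ^ q := by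
  have hγ : 0 < γ := hq.trans hqγ
  have hL0 : 0 < L := by linarith
  have hC := velocityConst_pos hγ1 hqγ
  have hle : ∀ x : ℝ, 0 ≤ x → (1 + x) ^ q ≤ (L + x) ^ q := fun x hx => by gcongr
  have hgrowth' : ∀ t ∈ Icc a c, ∀ x, 0 ≤ x → |φ t x| ≤ N * (L + x) ^ q := fun t ht x hx =>
    (hgrowth t ht x hx).trans (by gcongr)
  -- A bound `K` on a subinterval controls the velocity and hence the exponential growth rate there.
  have hstep : ∀ a' c' K K₀ : ℝ, a ≤ a' → c' ≤ c → 0 ≤ K →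
      (∀ t ∈ Icc a' c', ∀ x, 0 ≤ x → |φ t x| ≤ K * (L + x) ^ q) →
      (∀ x, 0 ≤ x → |φ a' x| ≤ K₀ * (L + x) ^ q) →
      ∀ t ∈ Icc a' c', ∀ x, 0 ≤ x → |φ t x| ≤
        K₀ * Real.exp (q * (velocityConst γ q * K * L ^ (q - γ)) * (t - a')) * (L + x) ^ q := by
    intro a' c' K K₀ ha' hc' hK hbd hbd₀
    have hsub : Icc a' c' ⊆ Icc a c := Icc_subset_Icc ha' hc'
    refine weighted_bound_of_homogeneous_transport (φt := φt) (φx := φx)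
      (b := fun t x => σ * velocity γ (φ t) x) hL hq.le (by positivity)
      (hcont.mono (prod_mono_left hsub)) (fun t ht => hzero t (hsub ht)) hbd
      (fun t ht' x hx' => (ht t (hsub ht') x hx').mono hsub)
      (fun t ht' x hx' => hx t (hsub ht') x hx') (fun t ht' x hx' => heq t (hsub ht') x hx')
      (fun t ht' x hx' => ?_) hbd₀
    rw [abs_mul, hσ, one_mul]
    exact abs_velocity_le_linear hγ hγ1 hq.le hqγ hL0 hK (fun y hy => hbd t ht' y hy.le)
      (hcontx t (hsub ht')) hx'.le
  set M := q * (velocityConst γ q * N * L ^ (q - γ)) with hM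
  have hM0 : 0 ≤ M := by positivity
  have hlog : 0 < Real.log (4 / 3) := Real.log_pos (by norm_num)
  -- Over a time `η` the crude bound `N` permits growth by at most `4/3`. By `hLarge` the bound `2
  -- N₀` improves itself to `3/2 N₀`, and `3/2 * 4/3 = 2` closes the induction, so `N` disappears
  -- from the result.
  set η := Real.log (4 / 3) / (M + 1) with hη
  have hη0 : 0 < η := by positivity
  have hMη : M * η ≤ Real.log (4 / 3) := by
    rw [hη, mul_div_assoc', div_le_iff₀ (by positivity)]
    nlinarith
  have hind : ∀ n : ℕ, ∀ t ∈ Icc a c, t ≤ a + n * η → ∀ x, 0 ≤ x →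
      |φ t x| ≤ 2 * N₀ * (L + x) ^ q := by
    intro n
    induction n with
    | zero =>
      intro t ht' hta x hx'
      have : t = a := le_antisymm (by simpa using hta) ht'.1
      have h1 := hinit x hx'
      have h2 := hle x hx'
      have h3 : 0 ≤ (L + x) ^ q := by positivity
      rw [this]
      nlinarith
    | succ n ih =>
      intro t ht' hta x hx'
      rcases le_or_gt t (a + n * η) with htn | htn
      · exact ih t ht' htn x hx'
      set d := a + n * η with hd
      have had : a ≤ d := by
        have : 0 ≤ n * η := by positivity
        linarith
      have hdc : d ≤ c := htn.le.trans ht'.2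
      have hmid : ∀ x, 0 ≤ x → |φ d x| ≤ 3 / 2 * N₀ * (L + x) ^ q := by
        intro x hx'
        have h := hstep a d (2 * N₀) N₀ le_rfl hdc (by positivity)
          (fun s hs => ih s ⟨hs.1, hs.2.trans hdc⟩ hs.2)
          (fun x hx' => (hinit x hx').trans (by gcongr)) d ⟨had, le_rfl⟩ x hx'
        refine h.trans ?_
        have : Real.exp (q * (velocityConst γ q * (2 * N₀) * L ^ (q - γ)) * (d - a)) ≤ 3 / 2 := by
          rw [← Real.le_log_iff_exp_le (by norm_num)]
          refine le_trans ?_ hLarge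
          gcongr
          linarith
        calc N₀ * Real.exp (q * (velocityConst γ q * (2 * N₀) * L ^ (q - γ)) * (d - a)) *
              (L + x) ^ q ≤ N₀ * (3 / 2) * (L + x) ^ q := by gcongr
          _ = _ := by ring
      have h := hstep d t N (3 / 2 * N₀) had ht'.2 hN
        (fun s hs => hgrowth' s ⟨had.trans hs.1, hs.2.trans ht'.2⟩) hmid t ⟨htn.le, le_rfl⟩ x hx'
      refine h.trans ?_
      have : Real.exp (M * (t - d)) ≤ 4 / 3 := by
        rw [← Real.le_log_iff_exp_le (by norm_num)]
        refine le_trans ?_ hMη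
        gcongr
        push_cast at hta
        linarith
      calc 3 / 2 * N₀ * Real.exp (M * (t - d)) * (L + x) ^ q
          ≤ 3 / 2 * N₀ * (4 / 3) * (L + x) ^ q := by gcongr
        _ = _ := by ring
  intro t ht' x hx'
  obtain ⟨n, hn⟩ := exists_nat_ge ((c - a) / η)
  rw [div_le_iff₀ hη0] at hn
  exact hind n t ht' (by linarith [ht'.2]) x hx'

/-! ### Uniform bounds in time and comparison of solutions -/

section solution

variable {γ q T : ℝ} {ω₀ : ℝ → ℝ} {ω : ℝ → ℝ → ℝ}

theorem IsSolution.hasDerivAt (h : IsSolution γ q T ω₀ ω) {t : ℝ} (ht : t ∈ Icc 0 T) (x : ℝ) :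
    HasDerivAt (ω t) (deriv (ω t) x) x := by
  refine DifferentiableAt.hasDerivAt ?_
  have h1 := (h.contDiffOn.differentiableOn (by norm_num)) (t, x) ⟨ht, mem_univ _⟩
  have h2 : DifferentiableWithinAt ℝ (fun y : ℝ => (t, y)) univ x := by fun_prop
  have := DifferentiableWithinAt.comp x h1 h2 (fun y _ => ⟨ht, mem_univ _⟩)
  exact differentiableWithinAt_univ.1 this

theorem IsSolution.hasDerivWithinAt (h : IsSolution γ q T ω₀ ω) {t : ℝ} (ht : t ∈ Icc 0 T)
    (x : ℝ) : HasDerivWithinAt (fun s => ω s x) (derivWithin (fun s => ω s x) (Icc 0 T) t)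
      (Icc 0 T) t := by
  refine DifferentiableWithinAt.hasDerivWithinAt ?_
  have h1 := (h.contDiffOn.differentiableOn (by norm_num)) (t, x) ⟨ht, mem_univ _⟩
  have h2 : DifferentiableWithinAt ℝ (fun s : ℝ => (s, x)) (Icc 0 T) t := by fun_prop
  exact DifferentiableWithinAt.comp t h1 h2 fun y hy =>
    (⟨hy, mem_univ _⟩ : (y, x) ∈ Icc (0 : ℝ) T ×ˢ (univ : Set ℝ))

theorem IsSolution.continuous (h : IsSolution γ q T ω₀ ω) {t : ℝ} (ht : t ∈ Icc 0 T) :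
    Continuous (ω t) :=
  continuous_iff_continuousAt.2 fun x => (h.hasDerivAt ht x).continuousAt

theorem IsSolution.apply_zero (h : IsSolution γ q T ω₀ ω) {t : ℝ} (ht : t ∈ Icc 0 T) :
    ω t 0 = 0 := by
  have := h.odd t ht 0
  rw [neg_zero] at this
  linarith

theorem exists_weight_shift {γ q : ℝ} (hqγ : q < γ) (T N₀ : ℝ) :
    ∃ L : ℝ, 1 ≤ L ∧
      q * (velocityConst γ q * (2 * N₀) * L ^ (q - γ)) * T ≤ Real.log (3 / 2) := by
  have h1 : Tendsto (fun L : ℝ => q * (velocityConst γ q * (2 * N₀) * L ^ (-(γ - q))) * T) atTop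
      (𝓝 (q * (velocityConst γ q * (2 * N₀) * 0) * T)) :=
    ((((tendsto_rpow_neg_atTop (sub_pos.2 hqγ)).const_mul _).const_mul _).mul_const _)
  have h2 : (0 : ℝ) < Real.log (3 / 2) := Real.log_pos (by norm_num)
  have h3 := h1.eventually_le_const (u := Real.log (3 / 2)) (by simpa using h2)
  obtain ⟨L, hL, hL1⟩ := (h3.and (eventually_ge_atTop 1)).exists
  exact ⟨L, hL1, by simpa using hL⟩

/-- Control at the right endpoint is reduced to control at the left one by `t ↦ a + c - t`, which
flips the sign of the velocity; this is the case `σ = -1`. -/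
theorem IsSolution.bound_of_endpoint (hq : 0 < q) (hqγ : q < γ) (hγ1 : γ < 1)
    (h : IsSolution γ q T ω₀ ω) {a c L N N₀ : ℝ} (ha : 0 ≤ a) (hc : c ≤ T)
    (hL : 1 ≤ L) (hN : 0 ≤ N) (hN₀ : 0 < N₀)
    (hgrowth : ∀ t ∈ Icc a c, ∀ x, 0 ≤ x → |ω t x| ≤ N * (1 + x) ^ q)
    (hend : (∀ x, 0 ≤ x → |ω a x| ≤ N₀ * (1 + x) ^ q) ∨
      (∀ x, 0 ≤ x → |ω c x| ≤ N₀ * (1 + x) ^ q))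
    (hLarge : q * (velocityConst γ q * (2 * N₀) * L ^ (q - γ)) * T ≤ Real.log (3 / 2)) :
    ∀ t ∈ Icc a c, ∀ x, 0 ≤ x → |ω t x| ≤ 2 * N₀ * (L + x) ^ q := by
  have hsub : Icc a c ⊆ Icc 0 T := Icc_subset_Icc ha hc
  rcases hend with hend | hend
  · refine weighted_bound_of_nonlinear_transport (σ := 1) (φ := ω)
      (φt := fun t x => derivWithin (fun s => ω s x) (Icc 0 T) t)
      (φx := fun t x => deriv (ω t) x) hq hqγ hγ1 (by simp)
      (by linarith) hL hN hN₀
      (h.contDiffOn.continuousOn.mono (prod_mono hsub (subset_univ _)))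
      (fun t ht => h.continuous (hsub ht)) (fun t ht => h.apply_zero (hsub ht)) hgrowth
      (fun t ht x _ => (h.hasDerivWithinAt (hsub ht) x).mono hsub)
      (fun t ht x _ => h.hasDerivAt (hsub ht) x) (fun t ht x _ => ?_) hend hLarge
    have := h.equation t (hsub ht) x
    linarith
  · have href : ∀ t ∈ Icc a c, a + c - t ∈ Icc a c := fun t ht =>
      ⟨by linarith [ht.2], by linarith [ht.1]⟩
    have key := weighted_bound_of_nonlinear_transport (σ := -1) (φ := fun t => ω (a + c - t))
      (φt := fun t x => derivWithin (fun s => ω s x) (Icc 0 T) (a + c - t) * (-1))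
      (φx := fun t x => deriv (ω (a + c - t)) x) (a := a) (c := c) hq hqγ hγ1 (by simp)
      (by linarith) hL hN hN₀
      ((h.contDiffOn.continuousOn.comp (f := fun z : ℝ × ℝ => (a + c - z.1, z.2)) (by fun_prop)
        fun z hz => ⟨hsub (href z.1 hz.1), mem_univ _⟩))
      (fun t ht => h.continuous (hsub (href t ht))) (fun t ht => h.apply_zero (hsub (href t ht)))
      (fun t ht => hgrowth _ (href t ht))
      (fun t ht x _ => ?_)
      (fun t ht x _ => h.hasDerivAt (hsub (href t ht)) x) (fun t ht x _ => ?_)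
      (by simpa using hend) hLarge
    · intro t ht x hx
      have := key (a + c - t) (href t ht) x hx
      simpa using this
    · exact ((h.hasDerivWithinAt (hsub (href t ht)) x).mono hsub).comp (h := fun t => a + c - t) t
        (((hasDerivAt_id t).const_sub (a + c)).hasDerivWithinAt) href
    · have := h.equation _ (hsub (href t ht)) x
      linarith

/-- The weighted norm of a solution is bounded uniformly in time. -/
theorem IsSolution.exists_uniform_bound (hq : 0 < q) (hqγ : q < γ) (hγ1 : γ < 1)
    (h : IsSolution γ q T ω₀ ω) :
    ∃ N : ℝ, 0 ≤ N ∧ ∀ t ∈ Icc 0 T, ∀ x, 0 ≤ x → |ω t x| ≤ N * (1 + x) ^ q := by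
  set E : ℕ → Set ℝ := fun n => {t | ∀ x, 0 ≤ x → |ω t x| ≤ n * (1 + x) ^ q} with hE
  choose L hL1 hL using fun n : ℕ => exists_weight_shift (q := q) hqγ T (n + 1)
  suffices hex : ∃ m, Icc 0 T ⊆ E m by
    obtain ⟨m, hm⟩ := hex
    exact ⟨m, Nat.cast_nonneg m, fun t ht => hm ht⟩
  -- `F n` comes from `(L n + x) ^ q ≤ L n ^ q * (1 + x) ^ q`, which returns to the unshifted
  -- weight; `n + 1` replaces `n` to have a positive constant.
  refine exists_Icc_subset_of_endpoint_control (T := T) (E := E)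
    (F := fun n => ⌈2 * ((n : ℝ) + 1) * L n ^ q⌉₊) ?_ ?_ ?_ ?_
  · intro m n hmn t ht x hx
    have : (m : ℝ) ≤ n := by exact_mod_cast hmn
    exact (ht x hx).trans (by gcongr)
  · intro n
    have : E n ∩ Icc 0 T = ⋂ (x : ℝ) (_ : 0 ≤ x),
        Icc 0 T ∩ (fun t => |ω t x|) ⁻¹' Iic (n * (1 + x) ^ q) := by
      ext t
      simp only [hE, mem_inter_iff, mem_ofPred_eq, mem_iInter, mem_preimage, mem_Iic]
      exact ⟨fun ht x hx => ⟨ht.2, ht.1 x hx⟩, fun ht =>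
        ⟨fun x hx => (ht x hx).2, (ht 0 le_rfl).1⟩⟩
    rw [this]
    refine isClosed_iInter fun x => isClosed_iInter fun _ => ?_
    refine ContinuousOn.preimage_isClosed_of_isClosed (fun t ht => ?_) isClosed_Icc isClosed_Iic
    exact (h.hasDerivWithinAt ht x).continuousWithinAt.abs
  · intro t ht
    obtain ⟨N, -, hN⟩ := exists_bound_of_weightedNorm_lt_top
      (ENNReal.add_lt_top.1 (h.growth t ht)).1
    refine ⟨⌈N⌉₊, fun x hx => (hN x hx).trans ?_⟩
    have := Nat.le_ceil N
    gcongr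
  · intro a c n m ha hac hc hsub hend t ht x hx
    have hn : (0 : ℝ) < n + 1 := by positivity
    have hend' : ∀ s, s ∈ E n → ∀ x, 0 ≤ x → |ω s x| ≤ ((n : ℝ) + 1) * (1 + x) ^ q :=
      fun s hs x hx => (hs x hx).trans (by gcongr; linarith)
    have key := h.bound_of_endpoint hq hqγ hγ1 ha hc (hL1 n) (Nat.cast_nonneg m) hn
      (fun s hs => hsub hs) (hend.imp (hend' a) (hend' c)) (hL n) t ht x hx
    refine key.trans ?_
    have hLn : 0 < L n := zero_lt_one.trans_le (hL1 n)
    have h1 : (L n + x) ^ q ≤ L n ^ q * (1 + x) ^ q := by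
      rw [← Real.mul_rpow hLn.le (by linarith)]
      have := hL1 n
      gcongr
      nlinarith
    calc 2 * ((n : ℝ) + 1) * (L n + x) ^ q ≤ 2 * ((n : ℝ) + 1) * (L n ^ q * (1 + x) ^ q) := by
          gcongr
      _ = 2 * ((n : ℝ) + 1) * L n ^ q * (1 + x) ^ q := by ring
      _ ≤ _ := by
          gcongr
          exact Nat.le_ceil _

/-- A solution whose derivative is bounded in the weighted norm uniformly in time is the only
solution. -/
theorem IsSolution.eq_of_uniform_deriv_bound (hq : 0 < q) (hqγ : q < γ) (hγ1 : γ < 1)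
    {ω₁ ω₂ : ℝ → ℝ → ℝ} (h₁ : IsSolution γ q T ω₀ ω₁) (h₂ : IsSolution γ q T ω₀ ω₂) {M : ℝ}
    (hM : 0 ≤ M)
    (hderiv : ∀ t ∈ Icc 0 T, ∀ x, 0 ≤ x → |deriv (ω₁ t) x| ≤ M * (1 + x) ^ (q - 1)) :
    ∀ t ∈ Icc 0 T, ∀ x, ω₂ t x = ω₁ t x := by
  have hγ : 0 < γ := hq.trans hqγ
  obtain ⟨N₁, hN₁, hb₁⟩ := h₁.exists_uniform_bound hq hqγ hγ1
  obtain ⟨N₂, hN₂, hb₂⟩ := h₂.exists_uniform_bound hq hqγ hγ1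
  -- `q < p` is needed by the maximum principle, `p < γ` by the velocity bound for the difference.
  obtain ⟨p, hqp, hpγ⟩ := exists_between hqγ
  have hp : 0 < p := hq.trans hqp
  have hC := velocityConst_pos hγ1 hqγ
  have hC' := velocityConst_pos hγ1 hpγ
  have hnonneg : ∀ t ∈ Icc 0 T, ∀ x, 0 ≤ x → ω₂ t x = ω₁ t x := by
    intro t ht x hx
    have key := weighted_bound_of_transport (φ := fun t x => ω₂ t x - ω₁ t x)
      (φt := fun t x => derivWithin (fun s => ω₂ s x) (Icc 0 T) t -
        derivWithin (fun s => ω₁ s x) (Icc 0 T) t)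
      (φx := fun t x => deriv (ω₂ t) x - deriv (ω₁ t) x)
      (b := fun t x => velocity γ (ω₂ t) x)
      (r := fun t x => -(velocity γ (fun y => ω₂ t y - ω₁ t y) x * deriv (ω₁ t) x))
      (a := 0) (c := T) (L := 1) (q := q) (p := p) (N := N₂ + N₁) (N₀ := 0)
      (B := velocityConst γ q * N₂) (R := velocityConst γ p * M) le_rfl hqp hp.le
      (by positivity) (by positivity)
      ((h₂.contDiffOn.continuousOn.sub h₁.contDiffOn.continuousOn).mono
        (prod_mono_right (subset_univ _)))
      (fun t ht => by simp [h₁.apply_zero ht, h₂.apply_zero ht])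
      (fun t ht x hx => ?_)
      (fun t ht x _ => (h₂.hasDerivWithinAt ht x).sub (h₁.hasDerivWithinAt ht x))
      (fun t ht x _ => (h₂.hasDerivAt ht x).sub (h₁.hasDerivAt ht x))
      (fun t ht x hx => ?_) (fun t ht x hx => ?_) (fun t ht K hK x hx => ?_)
      (fun x _ => by simp [h₁.initial, h₂.initial]) t ht x hx
    · have : |ω₂ t x - ω₁ t x| ≤ 0 := by simpa using key
      exact sub_eq_zero.1 (abs_nonpos_iff.1 this)
    · have e₁ := hb₁ t ht x hx
      have e₂ := hb₂ t ht x hx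
      have := abs_sub (ω₂ t x) (ω₁ t x)
      linarith
    · rw [velocity_sub
        (integrableOn_kernel_mul hγ hγ1 hq.le hqγ one_pos hN₂ (fun y hy => hb₂ t ht y hy.le)
          (h₂.continuous ht) hx.le)
        (integrableOn_kernel_mul hγ hγ1 hq.le hqγ one_pos hN₁ (fun y hy => hb₁ t ht y hy.le)
          (h₁.continuous ht) hx.le)]
      have e₁ := h₁.equation t ht x
      have e₂ := h₂.equation t ht x
      linear_combination e₂ - e₁
    · have := abs_velocity_le_linear hγ hγ1 hq.le hqγ one_pos hN₂
        (fun y hy => hb₂ t ht y hy.le) (h₂.continuous ht) hx.le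
      simpa using this
    · have hK0 : 0 ≤ K := by
        have h := (abs_nonneg _).trans (hK 0 le_rfl)
        simpa using h
      have hx1 : 0 < 1 + x := by linarith
      have e₁ := abs_velocity_le hγ hγ1 hp.le hpγ one_pos hK0 (fun y hy => hK y hy.le)
        ((h₂.continuous ht).sub (h₁.continuous ht)) hx.le
      have e₂ := hderiv t ht x hx.le
      rw [abs_neg, abs_mul]
      calc _ ≤ (velocityConst γ p * K * (1 + x) ^ (1 - γ + p)) * (M * (1 + x) ^ (q - 1)) := by
            gcongr
        _ = velocityConst γ p * M * K * ((1 + x) ^ (1 - γ + p) * (1 + x) ^ (q - 1)) := by ring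
        -- The exponents add up to `p - (γ - q) ≤ p`.
        _ ≤ velocityConst γ p * M * K * (1 + x) ^ p := by
            rw [← Real.rpow_add hx1]
            gcongr
            · linarith
            · linarith
  intro t ht x
  rcases le_total 0 x with hx | hx
  · exact hnonneg t ht x hx
  · have := hnonneg t ht (-x) (by linarith)
    rw [h₁.odd t ht, h₂.odd t ht] at this
    linarith

end solution

/-! ### The Riesz potential of functions with algebraic decay -/

/-- An integrable majorant for products of `|·|^{-γ}` and `(1 + |·|)^{q - 1}`. -/
def rieszMajorant (γ q z : ℝ) : ℝ :=
  (Icc (-1) 1).indicator (fun z : ℝ => |z| ^ (-γ)) z + 4 * (1 + ‖z‖) ^ (-(1 + γ - q))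

theorem integrable_rieszMajorant {γ q : ℝ} (hqγ : q < γ) (hγ1 : γ < 1) :
    Integrable (rieszMajorant γ q) := by
  refine Integrable.add ?_ ((integrable_one_add_norm (by simp; linarith)).const_mul 4)
  rw [integrable_indicator_iff measurableSet_Icc, integrableOn_Icc_iff_integrableOn_Ioc,
    ← intervalIntegrable_iff_integrableOn_Ioc_of_le (by norm_num)]
  exact intervalIntegrable_abs_rpow_neg hγ1 _ _

theorem rieszMajorant_nonneg (γ q z : ℝ) : 0 ≤ rieszMajorant γ q z := by
  have h : 0 ≤ (Icc (-1) 1).indicator (fun z : ℝ => |z| ^ (-γ)) z :=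
    indicator_nonneg (fun z _ => by positivity) z
  unfold rieszMajorant
  positivity

/-- For `|x - y| ≤ 1` the weight is at most `1` and the singularity is integrable. Otherwise,
replacing the larger of `|x - y|` and `1 + |y|` by the smaller leaves a single power of exponent
`-(1 + γ - q) < -1`; the factor `4` pays for `1 + |x - y| ≤ 2 |x - y|`. -/
theorem abs_sub_rpow_mul_le_rieszMajorant {γ q : ℝ} (hq : 0 < q) (hqγ : q < γ) (hγ1 : γ < 1)
    (x y : ℝ) : |x - y| ^ (-γ) * (1 + |y|) ^ (q - 1) ≤
      rieszMajorant γ q (x - y) + rieszMajorant γ q y := by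
  have hb : 1 ≤ 1 + |y| := by linarith [abs_nonneg y]
  have hb0 : 0 < 1 + |y| := by linarith
  rcases le_or_gt |x - y| 1 with h | h
  · have h1 : (1 + |y|) ^ (q - 1) ≤ 1 := Real.rpow_le_one_of_one_le_of_nonpos hb (by linarith)
    have h2 : |x - y| ^ (-γ) ≤ rieszMajorant γ q (x - y) := by
      rw [rieszMajorant, indicator_of_mem (show x - y ∈ Icc (-1) 1 from abs_le.1 h)]
      have : 0 ≤ 4 * (1 + ‖x - y‖) ^ (-(1 + γ - q)) := by positivity
      linarith
    have h3 := rieszMajorant_nonneg γ q y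
    have h4 : |x - y| ^ (-γ) * (1 + |y|) ^ (q - 1) ≤ |x - y| ^ (-γ) :=
      mul_le_of_le_one_right (by positivity) h1
    linarith
  · have ha0 : 0 < |x - y| := by linarith
    have hmaj : ∀ z, 4 * (1 + |z|) ^ (-(1 + γ - q)) ≤ rieszMajorant γ q z := by
      intro z
      rw [rieszMajorant, Real.norm_eq_abs]
      have : 0 ≤ (Icc (-1) 1).indicator (fun z : ℝ => |z| ^ (-γ)) z :=
        indicator_nonneg (fun z _ => by positivity) z
      linarith
    rcases le_total |x - y| (1 + |y|) with hab | hab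
    · have h1 : (1 + |y|) ^ (q - 1) ≤ |x - y| ^ (q - 1) :=
        Real.rpow_le_rpow_of_nonpos ha0 hab (by linarith)
      have h2 : |x - y| ^ (-γ) * (1 + |y|) ^ (q - 1) ≤ |x - y| ^ (-(1 + γ - q)) := by
        calc _ ≤ |x - y| ^ (-γ) * |x - y| ^ (q - 1) := by gcongr
          _ = _ := by rw [← Real.rpow_add ha0]; congr 1; ring
      have h3 : (2 * |x - y|) ^ (-(1 + γ - q)) ≤ (1 + |x - y|) ^ (-(1 + γ - q)) :=
        Real.rpow_le_rpow_of_nonpos (by linarith) (by linarith) (by linarith)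
      rw [Real.mul_rpow (by norm_num) ha0.le] at h3
      have h4 : (1 / 4 : ℝ) ≤ 2 ^ (-(1 + γ - q)) := by
        calc (1 / 4 : ℝ) = 2 ^ (-2 : ℝ) := by rw [Real.rpow_neg (by norm_num)]; norm_num
          _ ≤ _ := Real.rpow_le_rpow_of_exponent_le (by norm_num) (by linarith)
      have h5 : 1 / 4 * |x - y| ^ (-(1 + γ - q)) ≤
          2 ^ (-(1 + γ - q)) * |x - y| ^ (-(1 + γ - q)) := by gcongr
      have h6 := hmaj (x - y)
      have h7 := rieszMajorant_nonneg γ q y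
      linarith
    · have h1 : |x - y| ^ (-γ) ≤ (1 + |y|) ^ (-γ) :=
        Real.rpow_le_rpow_of_nonpos hb0 hab (by linarith)
      have h2 : |x - y| ^ (-γ) * (1 + |y|) ^ (q - 1) ≤ (1 + |y|) ^ (-(1 + γ - q)) := by
        calc _ ≤ (1 + |y|) ^ (-γ) * (1 + |y|) ^ (q - 1) := by gcongr
          _ = _ := by rw [← Real.rpow_add hb0]; congr 1; ring
      have h6 := hmaj y
      have h7 := rieszMajorant_nonneg γ q (x - y)
      have h8 : 0 ≤ (1 + |y|) ^ (-(1 + γ - q)) := by positivity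
      linarith

theorem integrable_abs_sub_rpow_mul {γ q : ℝ} (hq : 0 < q) (hqγ : q < γ) (hγ1 : γ < 1) (x : ℝ) :
    Integrable fun y : ℝ => |x - y| ^ (-γ) * (1 + |y|) ^ (q - 1) := by
  have hρ := integrable_rieszMajorant hqγ hγ1
  refine ((hρ.comp_sub_left x).add hρ).mono' (Measurable.aestronglyMeasurable (by fun_prop))
    (ae_of_all _ fun y => ?_)
  rw [Real.norm_of_nonneg (by positivity)]
  exact abs_sub_rpow_mul_le_rieszMajorant hq hqγ hγ1 x y

/-- A bound for the Riesz potential of `(1 + |·|)^{q - 1}`. -/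
def rieszConst (γ q : ℝ) : ℝ := 2 * ∫ z, rieszMajorant γ q z

theorem rieszConst_nonneg (γ q : ℝ) : 0 ≤ rieszConst γ q :=
  mul_nonneg (by norm_num) (integral_nonneg (rieszMajorant_nonneg γ q))

theorem integral_abs_sub_rpow_mul_le {γ q : ℝ} (hq : 0 < q) (hqγ : q < γ) (hγ1 : γ < 1) (x : ℝ) :
    ∫ y : ℝ, |x - y| ^ (-γ) * (1 + |y|) ^ (q - 1) ≤ rieszConst γ q := by
  have hρ := integrable_rieszMajorant hqγ hγ1
  refine (integral_mono (integrable_abs_sub_rpow_mul hq hqγ hγ1 x) ((hρ.comp_sub_left x).add hρ)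
    (abs_sub_rpow_mul_le_rieszMajorant hq hqγ hγ1 x)).trans_eq ?_
  simp only [Pi.add_apply]
  rw [integral_add (hρ.comp_sub_left x) hρ, integral_sub_left_eq_self, rieszConst]
  ring

/-! ### Odd flow maps -/

/-- The odd map with derivative `1 + v |x|`. -/
def flowMap (v : ℝ →ᵇ ℝ) (x : ℝ) : ℝ := x + ∫ s in (0 : ℝ)..x, v |s|

theorem continuous_comp_abs (v : ℝ →ᵇ ℝ) : Continuous fun s : ℝ => v |s| :=
  v.continuous.comp continuous_abs

theorem flowMap_sub (v : ℝ →ᵇ ℝ) (x y : ℝ) :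
    flowMap v x - flowMap v y = x - y + ∫ s in y..x, v |s| := by
  have h := intervalIntegral.integral_interval_sub_left (μ := volume)
    ((continuous_comp_abs v).intervalIntegrable 0 x)
    ((continuous_comp_abs v).intervalIntegrable 0 y)
  rw [flowMap, flowMap, ← h]
  ring

theorem abs_integral_comp_abs_le (v : ℝ →ᵇ ℝ) (x y : ℝ) :
    |(∫ s in y..x, v |s|)| ≤ ‖v‖ * |x - y| :=
  intervalIntegral.norm_integral_le_of_norm_le_const fun s _ => v.norm_coe_le_norm |s|

theorem abs_sub_le_two_mul_abs_flowMap_sub {v : ℝ →ᵇ ℝ} (hv : ‖v‖ ≤ 1 / 2) (x y : ℝ) :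
    |x - y| / 2 ≤ |flowMap v x - flowMap v y| := by
  rw [flowMap_sub]
  have h1 := abs_integral_comp_abs_le v x y
  have h2 := abs_sub_abs_le_abs_sub (x - y) (-∫ s in y..x, v |s|)
  rw [abs_neg, sub_neg_eq_add] at h2
  nlinarith [abs_nonneg (x - y)]

theorem abs_flowMap_sub_le {v : ℝ →ᵇ ℝ} (hv : ‖v‖ ≤ 1 / 2) (x y : ℝ) :
    |flowMap v x - flowMap v y| ≤ 3 / 2 * |x - y| := by
  rw [flowMap_sub]
  have h1 := abs_integral_comp_abs_le v x y
  have h2 := abs_add_le (x - y) (∫ s in y..x, v |s|)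
  nlinarith [abs_nonneg (x - y)]

theorem abs_flowMap_sub_sub_le (v w : ℝ →ᵇ ℝ) (x y : ℝ) :
    |flowMap v x - flowMap v y - (flowMap w x - flowMap w y)| ≤ ‖v - w‖ * |x - y| := by
  rw [flowMap_sub, flowMap_sub, add_sub_add_left_eq_sub, ← intervalIntegral.integral_sub
    ((continuous_comp_abs v).intervalIntegrable _ _)
    ((continuous_comp_abs w).intervalIntegrable _ _)]
  exact abs_integral_comp_abs_le (v - w) x y

theorem flowMap_neg (v : ℝ →ᵇ ℝ) (x : ℝ) : flowMap v (-x) = -flowMap v x := by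
  have h := intervalIntegral.integral_comp_neg (a := 0) (b := x) (fun s : ℝ => v |s|)
  simp only [abs_neg, neg_zero] at h
  rw [flowMap, flowMap, h, intervalIntegral.integral_symm]
  ring

theorem flowMap_zero (v : ℝ →ᵇ ℝ) : flowMap v 0 = 0 := by simp [flowMap]

theorem hasDerivAt_flowMap (v : ℝ →ᵇ ℝ) (x : ℝ) : HasDerivAt (flowMap v) (1 + v |x|) x :=
  (hasDerivAt_id x).add ((continuous_comp_abs v).integral_hasStrictDerivAt 0 x).hasDerivAt

theorem continuous_flowMap (v : ℝ →ᵇ ℝ) : Continuous (flowMap v) :=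
  continuous_iff_continuousAt.2 fun x => (hasDerivAt_flowMap v x).continuousAt

theorem half_le_one_add {v : ℝ →ᵇ ℝ} (hv : ‖v‖ ≤ 1 / 2) (x : ℝ) : 1 / 2 ≤ 1 + v x := by
  have := (abs_le.1 ((v.norm_coe_le_norm x).trans hv)).1
  linarith

theorem flowMap_bijective {v : ℝ →ᵇ ℝ} (hv : ‖v‖ ≤ 1 / 2) : Function.Bijective (flowMap v) := by
  refine ⟨fun x y hxy => ?_, ?_⟩
  · have := abs_sub_le_two_mul_abs_flowMap_sub hv x y
    rw [hxy, sub_self, abs_zero] at this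
    exact sub_eq_zero.1 (abs_nonpos_iff.1 (by linarith))
  · have hge : ∀ x : ℝ, 0 ≤ x → x / 2 ≤ flowMap v x := by
      intro x hx
      have h1 := (abs_le.1 (abs_integral_comp_abs_le v x 0)).1
      rw [sub_zero, abs_of_nonneg hx] at h1
      rw [flowMap]
      nlinarith
    refine (continuous_flowMap v).surjective ?_ ?_
    · exact tendsto_atTop_mono' _ ((eventually_ge_atTop 0).mono hge)
        (tendsto_id.atTop_div_const (by norm_num))
    · refine tendsto_atBot_mono' _ ((eventually_le_atBot 0).mono fun x hx => ?_)
        (tendsto_id.atBot_div_const (by norm_num : (0 : ℝ) < 2))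
      have := hge (-x) (by linarith)
      rw [flowMap_neg] at this
      simp only [id]
      linarith

/-! ### The Lagrangian vector field -/

/-- The velocity gradient in Lagrangian coordinates. -/
def strain (γ : ℝ) (g : ℝ → ℝ) (v : ℝ →ᵇ ℝ) (x : ℝ) : ℝ :=
  -∫ y, |flowMap v x - flowMap v y| ^ (-γ) * g y

theorem strain_neg {γ : ℝ} {g : ℝ → ℝ} (hg : ∀ y, g (-y) = g y) (v : ℝ →ᵇ ℝ) (x : ℝ) :
    strain γ g v (-x) = strain γ g v x := by
  rw [strain, strain, ← integral_neg_eq_self]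
  congr 1
  refine integral_congr_ae (ae_of_all _ fun y => ?_)
  simp only [flowMap_neg, hg]
  rw [← neg_sub', abs_neg]

theorem strain_abs {γ : ℝ} {g : ℝ → ℝ} (hg : ∀ y, g (-y) = g y) (v : ℝ →ᵇ ℝ) (x : ℝ) :
    strain γ g v |x| = strain γ g v x := by
  rcases abs_choice x with h | h <;> rw [h]
  exact strain_neg hg v x

/-! ### Boundedness, Lipschitz dependence and continuity of the strain -/

section strain

variable {γ q M : ℝ} {g : ℝ → ℝ} {v w : ℝ →ᵇ ℝ}

theorem abs_flowMap_sub_rpow_le (hγ : 0 < γ) (hγ1 : γ < 1) (hv : ‖v‖ ≤ 1 / 2) (x y : ℝ) :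
    |flowMap v x - flowMap v y| ^ (-γ) ≤ 2 * |x - y| ^ (-γ) := by
  rcases eq_or_ne x y with rfl | hxy
  · simp [Real.zero_rpow (neg_ne_zero.2 hγ.ne')]
  have h0 : 0 < |x - y| := abs_pos.2 (sub_ne_zero.2 hxy)
  calc |flowMap v x - flowMap v y| ^ (-γ) ≤ (|x - y| / 2) ^ (-γ) :=
        Real.rpow_le_rpow_of_nonpos (by positivity) (abs_sub_le_two_mul_abs_flowMap_sub hv x y)
          (by linarith)
    _ = 2 ^ γ * |x - y| ^ (-γ) := by
        rw [Real.div_rpow h0.le (by norm_num), div_eq_mul_inv, ← Real.rpow_neg (by norm_num),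
          neg_neg, mul_comm]
    _ ≤ 2 ^ (1 : ℝ) * |x - y| ^ (-γ) := by
        gcongr
        norm_num
    _ = _ := by rw [Real.rpow_one]

theorem norm_strain_integrand_le (hγ : 0 < γ) (hγ1 : γ < 1)
    (hgM : ∀ y, |g y| ≤ M * (1 + |y|) ^ (q - 1)) (hv : ‖v‖ ≤ 1 / 2) (x y : ℝ) :
    ‖|flowMap v x - flowMap v y| ^ (-γ) * g y‖ ≤
      2 * M * (|x - y| ^ (-γ) * (1 + |y|) ^ (q - 1)) := by
  rw [norm_mul, Real.norm_of_nonneg (by positivity), Real.norm_eq_abs]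
  calc _ ≤ (2 * |x - y| ^ (-γ)) * (M * (1 + |y|) ^ (q - 1)) := by
        have := abs_flowMap_sub_rpow_le hγ hγ1 hv x y
        have := hgM y
        gcongr
    _ = _ := by ring

theorem integrable_strain_integrand (hq : 0 < q) (hqγ : q < γ) (hγ1 : γ < 1) (hgc : Continuous g)
    (hgM : ∀ y, |g y| ≤ M * (1 + |y|) ^ (q - 1)) (hv : ‖v‖ ≤ 1 / 2) (x : ℝ) :
    Integrable fun y => |flowMap v x - flowMap v y| ^ (-γ) * g y := by
  have hm := (continuous_flowMap v).measurable
  have hgm := hgc.measurable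
  exact ((integrable_abs_sub_rpow_mul hq hqγ hγ1 x).const_mul (2 * M)).mono'
    (Measurable.aestronglyMeasurable (by fun_prop))
    (ae_of_all _ fun y => norm_strain_integrand_le (hq.trans hqγ) hγ1 hgM hv x y)

theorem abs_strain_le (hq : 0 < q) (hqγ : q < γ) (hγ1 : γ < 1) (hM : 0 ≤ M)
    (hgM : ∀ y, |g y| ≤ M * (1 + |y|) ^ (q - 1)) (hv : ‖v‖ ≤ 1 / 2) (x : ℝ) :
    |strain γ g v x| ≤ 2 * M * rieszConst γ q := by
  rw [strain, abs_neg]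
  refine (norm_integral_le_of_norm_le ((integrable_abs_sub_rpow_mul hq hqγ hγ1 x).const_mul (2 * M))
    (ae_of_all _ fun y => norm_strain_integrand_le (hq.trans hqγ) hγ1 hgM hv x y)).trans ?_
  rw [integral_const_mul]
  have := integral_abs_sub_rpow_mul_le hq hqγ hγ1 x
  gcongr

/-- The singularity does not worsen: the extra `|x - y|⁻¹` from the mean value inequality is
cancelled by the increment of the two flows, which differs by at most `‖v - w‖ |x - y|`. This makes
the Lagrangian field Lipschitz. -/
theorem abs_flowMap_sub_rpow_sub_le (hγ : 0 < γ) (hγ1 : γ < 1) (hv : ‖v‖ ≤ 1 / 2)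
    (hw : ‖w‖ ≤ 1 / 2) (x y : ℝ) :
    |(|flowMap v x - flowMap v y| ^ (-γ) - |flowMap w x - flowMap w y| ^ (-γ))| ≤
      4 * ‖v - w‖ * |x - y| ^ (-γ) := by
  rcases eq_or_ne x y with rfl | hxy
  · simp [Real.zero_rpow (neg_ne_zero.2 hγ.ne')]
  have h0 : 0 < |x - y| := abs_pos.2 (sub_ne_zero.2 hxy)
  have h1 := abs_rpow_neg_sub_rpow_neg_le hγ (half_pos h0)
    (abs_sub_le_two_mul_abs_flowMap_sub hv x y) (abs_sub_le_two_mul_abs_flowMap_sub hw x y)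
  have h2 := (abs_abs_sub_abs_le _ _).trans (abs_flowMap_sub_sub_le v w x y)
  have e2 : (|x - y| / 2) ^ (-γ - 1) * |x - y| = 2 ^ (γ + 1) * |x - y| ^ (-γ) := by
    rw [Real.div_rpow h0.le (by norm_num), div_eq_mul_inv, ← Real.rpow_neg (by norm_num),
      Real.rpow_sub_one h0.ne', show -(-γ - 1) = γ + 1 by ring]
    field_simp
  have e3 : (2 : ℝ) ^ (γ + 1) ≤ 4 := by
    calc (2 : ℝ) ^ (γ + 1) ≤ 2 ^ (2 : ℝ) :=
          Real.rpow_le_rpow_of_exponent_le (by norm_num) (by linarith)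
      _ = 4 := by norm_num
  calc _ ≤ γ * (|x - y| / 2) ^ (-γ - 1) * (‖v - w‖ * |x - y|) := h1.trans (by gcongr)
    _ = γ * ‖v - w‖ * ((|x - y| / 2) ^ (-γ - 1) * |x - y|) := by ring
    _ = γ * ‖v - w‖ * (2 ^ (γ + 1) * |x - y| ^ (-γ)) := by rw [e2]
    _ ≤ 1 * ‖v - w‖ * (4 * |x - y| ^ (-γ)) := by gcongr
    _ = _ := by ring

theorem abs_strain_sub_le (hq : 0 < q) (hqγ : q < γ) (hγ1 : γ < 1) (hM : 0 ≤ M)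
    (hgc : Continuous g) (hgM : ∀ y, |g y| ≤ M * (1 + |y|) ^ (q - 1)) (hv : ‖v‖ ≤ 1 / 2)
    (hw : ‖w‖ ≤ 1 / 2) (x : ℝ) :
    |strain γ g v x - strain γ g w x| ≤ 4 * M * rieszConst γ q * ‖v - w‖ := by
  have hγ := hq.trans hqγ
  rw [strain, strain, neg_sub_neg, abs_sub_comm, ← integral_sub
    (integrable_strain_integrand hq hqγ hγ1 hgc hgM hv x)
    (integrable_strain_integrand hq hqγ hγ1 hgc hgM hw x), ← Real.norm_eq_abs]
  refine (norm_integral_le_of_norm_le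
    ((integrable_abs_sub_rpow_mul hq hqγ hγ1 x).const_mul (4 * M * ‖v - w‖))
    (ae_of_all _ fun y => ?_)).trans ?_
  · rw [← sub_mul, norm_mul, Real.norm_eq_abs, Real.norm_eq_abs]
    calc _ ≤ (4 * ‖v - w‖ * |x - y| ^ (-γ)) * (M * (1 + |y|) ^ (q - 1)) := by
          have := abs_flowMap_sub_rpow_sub_le hγ hγ1 hv hw x y
          have := hgM y
          gcongr
      _ = _ := by ring
  · rw [integral_const_mul]
    have := integral_abs_sub_rpow_mul_le hq hqγ hγ1 x
    calc _ ≤ 4 * M * ‖v - w‖ * rieszConst γ q := by gcongr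
      _ = _ := by ring

/-- Substituting `y = x + z` pins the singularity at `z = 0`. Dominated convergence then applies for
`x` near `x₀`, the weight at `x + z` being comparable to that at `z` up to `(2 + |x₀|) ^ (1 - q)`.
-/
theorem continuous_strain (hq : 0 < q) (hqγ : q < γ) (hγ1 : γ < 1) (hM : 0 ≤ M)
    (hgc : Continuous g) (hgM : ∀ y, |g y| ≤ M * (1 + |y|) ^ (q - 1)) (hv : ‖v‖ ≤ 1 / 2) :
    Continuous (strain γ g v) := by
  have hγ := hq.trans hqγ
  have hXc := continuous_flowMap v
  have hm := hXc.measurable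
  have hgm := hgc.measurable
  refine Continuous.neg ?_
  have htrans : (fun x => ∫ y, |flowMap v x - flowMap v y| ^ (-γ) * g y) =
      fun x => ∫ z, |flowMap v x - flowMap v (x + z)| ^ (-γ) * g (x + z) := by
    funext x
    exact (integral_add_left_eq_self
      (fun y => |flowMap v x - flowMap v y| ^ (-γ) * g y) x).symm
  rw [htrans, continuous_iff_continuousAt]
  intro x₀
  refine continuousAt_of_dominated (bound := fun z =>
    2 * M * (2 + |x₀|) ^ (1 - q) * (|0 - z| ^ (-γ) * (1 + |z|) ^ (q - 1))) ?_ ?_ ?_ ?_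
  · exact Eventually.of_forall fun x => Measurable.aestronglyMeasurable (by fun_prop)
  · filter_upwards [Metric.ball_mem_nhds x₀ one_pos] with x hx
    refine ae_of_all _ fun z => ?_
    refine (norm_strain_integrand_le hγ hγ1 hgM hv x (x + z)).trans ?_
    have hxx : |x| ≤ 1 + |x₀| := by
      have h1 : |x - x₀| < 1 := by simpa [Real.dist_eq] using hx
      have h2 := abs_sub_abs_le_abs_sub x x₀
      linarith
    have h1 : 1 + |z| ≤ (2 + |x₀|) * (1 + |x + z|) := by
      have h2 : |z| ≤ |x + z| + |x| := by
        have := abs_sub (x + z) x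
        rwa [add_sub_cancel_left] at this
      nlinarith [abs_nonneg x₀, abs_nonneg (x + z)]
    have h2 : (1 + |x + z|) ^ (q - 1) ≤ (2 + |x₀|) ^ (1 - q) * (1 + |z|) ^ (q - 1) := by
      have h3 := Real.rpow_le_rpow_of_nonpos (by positivity) h1 (by linarith : q - 1 ≤ 0)
      rw [Real.mul_rpow (by positivity) (by positivity)] at h3
      have h4 : (2 + |x₀|) ^ (1 - q) * (2 + |x₀|) ^ (q - 1) = 1 := by
        rw [← Real.rpow_add (by positivity)]; simp
      calc (1 + |x + z|) ^ (q - 1)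
          = (2 + |x₀|) ^ (1 - q) * ((2 + |x₀|) ^ (q - 1) * (1 + |x + z|) ^ (q - 1)) := by
            rw [← mul_assoc, h4, one_mul]
        _ ≤ _ := by gcongr
    rw [sub_add_cancel_left, zero_sub]
    calc _ ≤ 2 * M * (|-z| ^ (-γ) * ((2 + |x₀|) ^ (1 - q) * (1 + |z|) ^ (q - 1))) := by gcongr
      _ = _ := by ring
  · exact (integrable_abs_sub_rpow_mul hq hqγ hγ1 0).const_mul _
  · filter_upwards [Measure.ae_ne volume (0 : ℝ)] with z hz
    refine ContinuousAt.mul (ContinuousAt.rpow_const (by fun_prop) (Or.inl ?_)) (by fun_prop)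
    refine abs_ne_zero.2 (sub_ne_zero.2 fun h => hz ?_)
    have := (flowMap_bijective hv).1 h
    linarith

end strain

open Classical in
/-- The vector field of the Lagrangian formulation on bounded continuous functions. -/
def lagrangianField (γ : ℝ) (g : ℝ → ℝ) (v : ℝ →ᵇ ℝ) : ℝ →ᵇ ℝ :=
  -- The default `0` plays no role for `‖v‖ ≤ 1/2`, where `lagrangianField_apply` holds.
  if h : Continuous (fun x => (1 + v x) * strain γ g v x) ∧
      ∃ C, ∀ x, ‖(1 + v x) * strain γ g v x‖ ≤ C then
    BoundedContinuousFunction.ofNormedAddCommGroup _ h.1 h.2.choose h.2.choose_spec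
  else 0

section field

variable {γ q M : ℝ} {g : ℝ → ℝ} {v w : ℝ →ᵇ ℝ}

theorem abs_one_add_le {v : ℝ →ᵇ ℝ} (hv : ‖v‖ ≤ 1 / 2) (x : ℝ) : |1 + v x| ≤ 3 / 2 := by
  have h := abs_le.1 ((v.norm_coe_le_norm x).trans hv)
  rw [abs_le]
  constructor <;> linarith [h.1, h.2]

theorem abs_one_add_mul_strain_le (hq : 0 < q) (hqγ : q < γ) (hγ1 : γ < 1) (hM : 0 ≤ M)
    (hgM : ∀ y, |g y| ≤ M * (1 + |y|) ^ (q - 1)) (hv : ‖v‖ ≤ 1 / 2) (x : ℝ) :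
    ‖(1 + v x) * strain γ g v x‖ ≤ 3 * M * rieszConst γ q := by
  rw [norm_mul, Real.norm_eq_abs, Real.norm_eq_abs]
  calc _ ≤ 3 / 2 * (2 * M * rieszConst γ q) := by
        have := abs_one_add_le hv x
        have := abs_strain_le hq hqγ hγ1 hM hgM hv x
        gcongr
    _ = _ := by ring

theorem lagrangianField_apply (hq : 0 < q) (hqγ : q < γ) (hγ1 : γ < 1) (hM : 0 ≤ M)
    (hgc : Continuous g) (hgM : ∀ y, |g y| ≤ M * (1 + |y|) ^ (q - 1)) (hv : ‖v‖ ≤ 1 / 2) (x : ℝ) :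
    lagrangianField γ g v x = (1 + v x) * strain γ g v x := by
  have hc := continuous_strain hq hqγ hγ1 hM hgc hgM hv
  have hvc := v.continuous
  rw [lagrangianField, dif_pos ⟨by fun_prop, _,
    abs_one_add_mul_strain_le hq hqγ hγ1 hM hgM hv⟩]
  rfl

theorem norm_lagrangianField_le (hq : 0 < q) (hqγ : q < γ) (hγ1 : γ < 1) (hM : 0 ≤ M)
    (hgc : Continuous g) (hgM : ∀ y, |g y| ≤ M * (1 + |y|) ^ (q - 1)) (hv : ‖v‖ ≤ 1 / 2) :
    ‖lagrangianField γ g v‖ ≤ 3 * M * rieszConst γ q := by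
  have := rieszConst_nonneg γ q
  refine (BoundedContinuousFunction.norm_le (by positivity)).2 fun x => ?_
  rw [lagrangianField_apply hq hqγ hγ1 hM hgc hgM hv]
  exact abs_one_add_mul_strain_le hq hqγ hγ1 hM hgM hv x

theorem norm_lagrangianField_sub_le (hq : 0 < q) (hqγ : q < γ) (hγ1 : γ < 1) (hM : 0 ≤ M)
    (hgc : Continuous g) (hgM : ∀ y, |g y| ≤ M * (1 + |y|) ^ (q - 1)) (hv : ‖v‖ ≤ 1 / 2)
    (hw : ‖w‖ ≤ 1 / 2) :
    ‖lagrangianField γ g v - lagrangianField γ g w‖ ≤ 8 * M * rieszConst γ q * ‖v - w‖ := by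
  have := rieszConst_nonneg γ q
  refine (BoundedContinuousFunction.norm_le (by positivity)).2 fun x => ?_
  rw [BoundedContinuousFunction.sub_apply, lagrangianField_apply hq hqγ hγ1 hM hgc hgM hv,
    lagrangianField_apply hq hqγ hγ1 hM hgc hgM hw]
  have h1 := abs_strain_le hq hqγ hγ1 hM hgM hv x
  have h2 := abs_strain_sub_le hq hqγ hγ1 hM hgc hgM hv hw x
  have h3 := abs_one_add_le hw x
  have h4 : |v x - w x| ≤ ‖v - w‖ := (v - w).norm_coe_le_norm x
  calc ‖(1 + v x) * strain γ g v x - (1 + w x) * strain γ g w x‖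
      = |(v x - w x) * strain γ g v x + (1 + w x) * (strain γ g v x - strain γ g w x)| := by
        rw [Real.norm_eq_abs]; congr 1; ring
    _ ≤ |v x - w x| * |strain γ g v x| + |1 + w x| * |strain γ g v x - strain γ g w x| := by
        rw [← abs_mul, ← abs_mul]; exact abs_add_le _ _
    _ ≤ ‖v - w‖ * (2 * M * rieszConst γ q) +
        3 / 2 * (4 * M * rieszConst γ q * ‖v - w‖) := by gcongr
    _ = _ := by ring

/-- Local solvability of the Lagrangian formulation. -/
theorem exists_lagrangian_solution (hq : 0 < q) (hqγ : q < γ) (hγ1 : γ < 1) (hM : 0 ≤ M)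
    (hgc : Continuous g) (hgM : ∀ y, |g y| ≤ M * (1 + |y|) ^ (q - 1)) :
    ∃ T : ℝ, 0 < T ∧ ∃ v : ℝ → ℝ →ᵇ ℝ, v 0 = 0 ∧ (∀ t ∈ Ioo (-T) T, ‖v t‖ < 1 / 2) ∧
      ContDiffOn ℝ 1 v (Ioo (-T) T) ∧
      ∀ t ∈ Ioo (-T) T, HasDerivAt v (lagrangianField γ g (v t)) t := by
  have hA := rieszConst_nonneg γ q
  set K : NNReal := ⟨3 * M * rieszConst γ q, by positivity⟩
  set K' : NNReal := ⟨8 * M * rieszConst γ q, by positivity⟩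
  -- At speed at most `K`, a time `ε` covers a distance `K ε ≤ 1/2`, so the trajectory stays in the
  -- ball where the field is controlled.
  set ε : ℝ := 1 / (2 * (K + 1)) with hε
  have hε0 : 0 < ε := by positivity
  have hKε : K * ε ≤ 1 / 2 := by
    rw [hε, mul_one_div, div_le_div_iff₀ (by positivity) (by norm_num)]
    have : (0 : ℝ) ≤ K := K.2
    linarith
  have hball : ∀ v : ℝ →ᵇ ℝ, v ∈ Metric.closedBall (0 : ℝ →ᵇ ℝ) ((1 / 2 : NNReal) : ℝ) →
      ‖v‖ ≤ 1 / 2 := by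
    intro v hv
    simpa using hv
  have hlip : LipschitzOnWith K' (lagrangianField γ g)
      (Metric.closedBall (0 : ℝ →ᵇ ℝ) ((1 / 2 : NNReal) : ℝ)) := by
    refine LipschitzOnWith.of_dist_le_mul fun v hv w hw => ?_
    rw [dist_eq_norm, dist_eq_norm]
    exact norm_lagrangianField_sub_le hq hqγ hγ1 hM hgc hgM (hball v hv) (hball w hw)
  have hPL : IsPicardLindelof (fun _ : ℝ => lagrangianField γ g) (tmin := -ε) (tmax := ε)
      ⟨0, by constructor <;> linarith⟩ 0 (1 / 2) 0 K K' := by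
    refine IsPicardLindelof.of_time_independent (fun v hv =>
      norm_lagrangianField_le hq hqγ hγ1 hM hgc hgM (hball v hv)) hlip ?_
    simpa using hKε
  obtain ⟨v, hv0, hv⟩ := hPL.exists_eq_forall_mem_Icc_hasDerivWithinAt₀
  simp only at hv0
  have hv' : ∀ t ∈ Ioo (-ε) ε, HasDerivAt v (lagrangianField γ g (v t)) t := fun t ht =>
    (hv t (Ioo_subset_Icc_self ht)).hasDerivAt (Icc_mem_nhds ht.1 ht.2)
  have hcont : ContinuousAt v 0 := (hv' 0 ⟨by linarith, hε0⟩).continuousAt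
  -- The strict inequality is needed because the inverse flow is shown to be `C¹` only on the open
  -- ball.
  have hsmall : ∀ᶠ t in 𝓝 (0 : ℝ), ‖v t‖ < 1 / 2 := by
    refine hcont.norm.eventually (gt_mem_nhds ?_)
    simp [hv0]
  obtain ⟨δ, hδ, hδv⟩ := Metric.eventually_nhds_iff.1 hsmall
  set T := min δ ε
  have hT : 0 < T := lt_min hδ hε0
  have hsub : Ioo (-T) T ⊆ Ioo (-ε) ε :=
    Ioo_subset_Ioo (neg_le_neg (min_le_right _ _)) (min_le_right _ _)
  have hhalf : ∀ t ∈ Ioo (-T) T, ‖v t‖ < 1 / 2 := fun t ht => by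
    refine hδv ?_
    rw [Real.dist_eq, sub_zero]
    exact (abs_lt.2 ht).trans_le (min_le_left _ _)
  refine ⟨T, hT, v, hv0, hhalf, ?_, fun t ht => hv' t (hsub ht)⟩
  rw [show (1 : WithTop ℕ∞) = 0 + 1 from rfl, contDiffOn_succ_iff_deriv_of_isOpen isOpen_Ioo]
  refine ⟨fun t ht => (hv' t (hsub ht)).differentiableAt.differentiableWithinAt, by simp, ?_⟩
  rw [contDiffOn_zero]
  have hvc : ContinuousOn v (Ioo (-T) T) := fun t ht =>
    (hv' t (hsub ht)).continuousAt.continuousWithinAt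
  refine (hlip.continuousOn.comp hvc fun t ht => ?_).congr fun t ht => (hv' t (hsub ht)).deriv
  simpa using (hhalf t ht).le

end field

/-! ### The velocity as a primitive of a Riesz potential -/

theorem integral_eq_integral_Ioi_add_neg {G : ℝ → ℝ} (hG : Integrable G) :
    ∫ y, G y = ∫ y in Ioi 0, (G y + G (-y)) := by
  have h1 : ∫ y in Ioi (0 : ℝ), G (-y) = ∫ y in Iic (0 : ℝ), G y := by
    simp
  rw [integral_add hG.integrableOn hG.comp_neg.integrableOn, h1, add_comm,
    intervalIntegral.integral_Iic_add_Ioi hG.integrableOn hG.integrableOn]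

section

variable {γ q M N x : ℝ} {f f' : ℝ → ℝ}

theorem integrable_abs_sub_rpow_mul_of_decay (hq : 0 < q) (hqγ : q < γ) (hγ1 : γ < 1)
    (hgc : Continuous f') (hgM : ∀ y, |f' y| ≤ M * (1 + |y|) ^ (q - 1)) (x : ℝ) :
    Integrable fun y => |x - y| ^ (-γ) * f' y := by
  have := integrable_strain_integrand (v := 0) hq hqγ hγ1 hgc hgM (by simp) x
  simpa [flowMap] using this

theorem integrable_prod_abs_sub_rpow_mul (hq : 0 < q) (hqγ : q < γ) (hγ1 : γ < 1)
    (hgc : Continuous f') (hgM : ∀ y, |f' y| ≤ M * (1 + |y|) ^ (q - 1)) (x : ℝ) :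
    Integrable (Function.uncurry fun s y : ℝ => |s - y| ^ (-γ) * f' y)
      ((volume.restrict (Ioc 0 x)).prod volume) := by
  have hgm := hgc.measurable
  have hmeas : Measurable (Function.uncurry fun s y : ℝ => |s - y| ^ (-γ) * f' y) := by
    unfold Function.uncurry
    fun_prop
  have hM : 0 ≤ M := by simpa using (abs_nonneg _).trans (hgM 0)
  rw [integrable_prod_iff hmeas.aestronglyMeasurable]
  refine ⟨ae_of_all _ fun s => integrable_abs_sub_rpow_mul_of_decay hq hqγ hγ1 hgc hgM s, ?_⟩
  refine Integrable.mono' (integrable_const (M * rieszConst γ q))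
    hmeas.norm.stronglyMeasurable.integral_prod_right.aestronglyMeasurable
    (ae_of_all _ fun s => ?_)
  rw [Real.norm_of_nonneg (integral_nonneg fun y => norm_nonneg _)]
  calc _ ≤ ∫ y, M * (|s - y| ^ (-γ) * (1 + |y|) ^ (q - 1)) := by
        refine integral_mono (integrable_abs_sub_rpow_mul_of_decay hq hqγ hγ1 hgc hgM s).norm
          ((integrable_abs_sub_rpow_mul hq hqγ hγ1 s).const_mul M) fun y => ?_
        simp only [Function.uncurry, norm_mul, Real.norm_eq_abs]
        rw [abs_of_nonneg (by positivity : 0 ≤ |s - y| ^ (-γ)), mul_left_comm]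
        have := hgM y
        gcongr
    _ ≤ _ := by
        rw [integral_const_mul]
        have := integral_abs_sub_rpow_mul_le hq hqγ hγ1 s
        gcongr

/-- By oddness the sum is the integral of `|s|^{-γ}` over `[R - x, R + x]`, far from the
singularity. This cancellation kills the boundary term in the integration by parts, although `f` may
grow like `R ^ q`. -/
theorem abs_kernelPrimitive_add_le (hγ : 0 < γ) (hγ1 : γ < 1) (hx : 0 ≤ x) {R : ℝ} (hR : 0 < R)
    (hxR : 2 * x ≤ R) :
    |kernelPrimitive γ (x - R) + kernelPrimitive γ (x + R)| ≤ 2 * x * (R / 2) ^ (-γ) := by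
  have h1 : kernelPrimitive γ (x - R) + kernelPrimitive γ (x + R) =
      ∫ s in (R - x)..(R + x), |s - 0| ^ (-γ) := by
    rw [integral_abs_sub_rpow_neg hγ1, ← neg_sub R x, kernelPrimitive_neg, sub_zero, sub_zero,
      add_comm x R]
    ring
  rw [h1]
  have h2 : ∀ s ∈ uIoc (R - x) (R + x), ‖|s - 0| ^ (-γ)‖ ≤ (R / 2) ^ (-γ) := by
    intro s hs
    rw [uIoc_of_le (by linarith)] at hs
    have h3 : R / 2 ≤ |s - 0| := by
      rw [sub_zero]
      exact le_trans (by linarith [hs.1]) (le_abs_self s)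
    rw [Real.norm_of_nonneg (by positivity)]
    exact Real.rpow_le_rpow_of_nonpos (by positivity) h3 (by linarith)
  refine (intervalIntegral.norm_integral_le_of_norm_le_const h2).trans_eq ?_
  rw [show R + x - (R - x) = 2 * x by ring, abs_of_nonneg (by linarith), mul_comm]

theorem tendsto_mul_kernelPrimitive_add (hq : 0 < q) (hqγ : q < γ) (hγ1 : γ < 1) (hN : 0 ≤ N)
    (hfN : ∀ y, 0 < y → |f y| ≤ N * (1 + y) ^ q) (hx : 0 ≤ x) :
    Tendsto (fun R => f R * (kernelPrimitive γ (x - R) + kernelPrimitive γ (x + R))) atTop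
      (𝓝 0) := by
  have hγ := hq.trans hqγ
  have hlim : Tendsto (fun R : ℝ => N * 2 ^ q * (2 * x * 2 ^ γ) * R ^ (-(γ - q))) atTop
      (𝓝 (N * 2 ^ q * (2 * x * 2 ^ γ) * 0)) :=
    (tendsto_rpow_neg_atTop (sub_pos.2 hqγ)).const_mul _
  rw [mul_zero] at hlim
  refine squeeze_zero_norm' ?_ hlim
  filter_upwards [eventually_ge_atTop (2 * x), eventually_ge_atTop 1] with R hR hR1
  have hR0 : 0 < R := by linarith
  rw [norm_mul, Real.norm_eq_abs, Real.norm_eq_abs]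
  have h1 : |f R| ≤ N * (2 ^ q * R ^ q) := by
    rw [← Real.mul_rpow (by norm_num) hR0.le]
    refine (hfN R hR0).trans ?_
    gcongr
    linarith
  have h2 := abs_kernelPrimitive_add_le hγ hγ1 hx hR0 hR
  have h3 : (R / 2) ^ (-γ) = 2 ^ γ * R ^ (-γ) := by
    rw [Real.div_rpow hR0.le (by norm_num), div_eq_mul_inv, ← Real.rpow_neg (by norm_num),
      neg_neg, mul_comm]
  rw [h3] at h2
  calc _ ≤ (N * (2 ^ q * R ^ q)) * (2 * x * (2 ^ γ * R ^ (-γ))) := by gcongr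
    _ = N * 2 ^ q * (2 * x * 2 ^ γ) * (R ^ q * R ^ (-γ)) := by ring
    _ = _ := by rw [← Real.rpow_add hR0]; congr 2; ring

/-- Fubini integrates the Riesz kernel in `s`, leaving `f'` against kernel primitives. Folding `y`
with `-y` and integrating by parts on `(0, R)` recovers `kernel`, with a boundary term that vanishes
as `R → ∞`. -/
theorem velocity_eq_of_nonneg (hq : 0 < q) (hqγ : q < γ) (hγ1 : γ < 1)
    (hf : ∀ x, HasDerivAt f (f' x) x) (hf0 : f 0 = 0) (heven : ∀ y, f' (-y) = f' y)
    (hgc : Continuous f') (hN : 0 ≤ N) (hfN : ∀ y, 0 < y → |f y| ≤ N * (1 + y) ^ q)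
    (hgM : ∀ y, |f' y| ≤ M * (1 + |y|) ^ (q - 1)) (hx : 0 ≤ x) :
    velocity γ f x = -∫ s in (0 : ℝ)..x, ∫ y, |s - y| ^ (-γ) * f' y := by
  have hγ := hq.trans hqγ
  have hfc : Continuous f := continuous_iff_continuousAt.2 fun x => (hf x).continuousAt
  have hprod := integrable_prod_abs_sub_rpow_mul hq hqγ hγ1 hgc hgM x
  set G : ℝ → ℝ := fun y => (kernelPrimitive γ (x - y) - kernelPrimitive γ (0 - y)) * f' y
    with hG
  have hinner : ∀ y, ∫ s in Ioc 0 x, |s - y| ^ (-γ) * f' y = G y := by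
    intro y
    rw [integral_mul_const, ← intervalIntegral.integral_of_le hx, integral_abs_sub_rpow_neg hγ1]
  have hGint : Integrable G := by
    refine hprod.integral_prod_right.congr (ae_of_all _ fun y => hinner y)
  have hGsum : ∀ y, G y + G (-y) =
      f' y * (kernelPrimitive γ (x - y) + kernelPrimitive γ (x + y)) := by
    intro y
    simp only [hG, heven, zero_sub, kernelPrimitive_neg, sub_neg_eq_add]
    ring
  have hfub : ∫ s in (0 : ℝ)..x, ∫ y, |s - y| ^ (-γ) * f' y =
      ∫ y in Ioi 0, f' y * (kernelPrimitive γ (x - y) + kernelPrimitive γ (x + y)) := by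
    rw [intervalIntegral.integral_of_le hx, integral_integral_swap hprod]
    simp only [hinner]
    rw [integral_eq_integral_Ioi_add_neg hGint]
    simp only [hGsum]
  have hKint1 : IntegrableOn
      (fun y => f' y * (kernelPrimitive γ (x - y) + kernelPrimitive γ (x + y))) (Ioi 0) := by
    simp only [← hGsum]
    exact (hGint.add hGint.comp_neg).integrableOn
  have hKint2 := integrableOn_kernel_mul hγ hγ1 hq.le hqγ one_pos hN hfN hfc hx
  have hKint := hKint1.sub hKint2
  have hk := continuous_kernelPrimitive hγ1
  have hftc : ∀ R, 0 ≤ R → ∫ y in (0 : ℝ)..R,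
      (f' y * (kernelPrimitive γ (x - y) + kernelPrimitive γ (x + y)) - kernel γ x y * f y) =
        f R * (kernelPrimitive γ (x - R) + kernelPrimitive γ (x + R)) := by
    intro R hR
    -- The primitive is continuous but not differentiable at `0`, hence the exceptional point `y =
    -- x`.
    have := integral_eq_of_hasDerivAt_off_countable_of_le
      (fun y => f y * (kernelPrimitive γ (x - y) + kernelPrimitive γ (x + y)))
      (fun y => f' y * (kernelPrimitive γ (x - y) + kernelPrimitive γ (x + y)) -
        kernel γ x y * f y) (s := {x}) hR (countable_singleton x)
      (by fun_prop) ?_ ?_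
    · rw [this, hf0]; ring
    · rintro y ⟨hy, hyx⟩
      have hyx : y ≠ x := hyx
      have h1 : HasDerivAt (fun y => kernelPrimitive γ (x - y)) (|x - y| ^ (-γ) * (-1)) y :=
        (hasDerivAt_kernelPrimitive hγ1 (sub_ne_zero.2 hyx.symm)).comp y
          ((hasDerivAt_id y).const_sub x)
      have h2 : HasDerivAt (fun y => kernelPrimitive γ (x + y)) (|x + y| ^ (-γ) * 1) y :=
        (hasDerivAt_kernelPrimitive hγ1 (by linarith [hy.1] : 0 < x + y).ne').comp y
          ((hasDerivAt_id y).const_add x)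
      convert! (hf y).mul (h1.add h2) using 1
      rw [kernel_eq, abs_sub_comm y x]
      simp only [Pi.add_apply]
      ring
    · rw [intervalIntegrable_iff_integrableOn_Ioc_of_le hR]
      exact hKint.mono_set Ioc_subset_Ioi_self
  have hzero : ∫ y in Ioi 0,
      (f' y * (kernelPrimitive γ (x - y) + kernelPrimitive γ (x + y)) - kernel γ x y * f y) = 0 := by
    refine tendsto_nhds_unique (intervalIntegral_tendsto_integral_Ioi 0 hKint tendsto_id) ?_
    refine (tendsto_mul_kernelPrimitive_add hq hqγ hγ1 hN hfN hx).congr' ?_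
    filter_upwards [eventually_ge_atTop 0] with R hR
    exact (hftc R hR).symm
  rw [integral_sub hKint1 hKint2] at hzero
  rw [velocity, hfub]
  linarith

theorem velocity_neg (γ : ℝ) (f : ℝ → ℝ) (x : ℝ) : velocity γ f (-x) = -velocity γ f x := by
  have h : (fun y => kernel γ (-x) y * f y) = fun y => -(kernel γ x y * f y) := by
    funext y
    simp only [kernel]
    rw [sub_neg_eq_add, neg_add_eq_sub, add_comm y x]
    ring
  simp only [velocity, h, integral_neg]

/-- The velocity of an odd function is a primitive of the Riesz potential of its derivative. -/
theorem velocity_eq_integral (hq : 0 < q) (hqγ : q < γ) (hγ1 : γ < 1)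
    (hf : ∀ x, HasDerivAt f (f' x) x) (hf0 : f 0 = 0) (heven : ∀ y, f' (-y) = f' y)
    (hgc : Continuous f') (hN : 0 ≤ N) (hfN : ∀ y, 0 < y → |f y| ≤ N * (1 + y) ^ q)
    (hgM : ∀ y, |f' y| ≤ M * (1 + |y|) ^ (q - 1)) (x : ℝ) :
    velocity γ f x = ∫ s in (0 : ℝ)..x, -∫ y, |s - y| ^ (-γ) * f' y := by
  rw [intervalIntegral.integral_neg]
  rcases le_total 0 x with hx | hx
  · exact velocity_eq_of_nonneg hq hqγ hγ1 hf hf0 heven hgc hN hfN hgM hx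
  · have h1 := velocity_eq_of_nonneg hq hqγ hγ1 hf hf0 heven hgc hN hfN hgM (neg_nonneg.2 hx)
    have h2 : ∀ s : ℝ, ∫ y, |-s - y| ^ (-γ) * f' y = ∫ y, |s - y| ^ (-γ) * f' y := by
      intro s
      rw [← integral_neg_eq_self]
      refine integral_congr_ae (ae_of_all _ fun y => ?_)
      simp only [heven]
      rw [← neg_sub', abs_neg]
    have h3 := intervalIntegral.integral_comp_neg (a := 0) (b := x)
      (fun s : ℝ => ∫ y, |s - y| ^ (-γ) * f' y)
    simp only [h2, neg_zero] at h3
    rw [velocity_neg] at h1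
    rw [h3, intervalIntegral.integral_symm]
    linarith

end

/-! ### Regularity of flow maps and their inverses -/

/-- The functional `v ↦ ∫_0^x v |s| ds`. -/
def displacement (x : ℝ) : (ℝ →ᵇ ℝ) →L[ℝ] ℝ :=
  LinearMap.mkContinuous
    { toFun := fun v => ∫ s in (0 : ℝ)..x, v |s|
      map_add' := fun v w => intervalIntegral.integral_add
        ((continuous_comp_abs v).intervalIntegrable _ _)
        ((continuous_comp_abs w).intervalIntegrable _ _)
      map_smul' := fun c v => intervalIntegral.integral_const_mul c _ }
    |x| fun v => by simpa [mul_comm] using abs_integral_comp_abs_le v x 0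

theorem displacement_apply (x : ℝ) (v : ℝ →ᵇ ℝ) :
    displacement x v = ∫ s in (0 : ℝ)..x, v |s| := rfl

theorem flowMap_eq (v : ℝ →ᵇ ℝ) (x : ℝ) : flowMap v x = x + displacement x v := rfl

/-- Continuity is in operator norm, as required for joint differentiability of the flow in `(v, x)`.
-/
theorem continuous_displacement : Continuous displacement := by
  suffices h : LipschitzWith 1 displacement from h.continuous
  refine LipschitzWith.of_dist_le_mul fun x y => ?_
  rw [dist_eq_norm, NNReal.coe_one, one_mul, Real.dist_eq]
  refine ContinuousLinearMap.opNorm_le_bound _ (abs_nonneg _) fun v => ?_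
  have h := flowMap_sub v x y
  rw [flowMap_eq, flowMap_eq] at h
  have : (displacement x - displacement y) v = ∫ s in y..x, v |s| := by
    rw [sub_apply]; linarith
  rw [this, mul_comm]
  exact abs_integral_comp_abs_le v x y

theorem continuous_eval_abs : Continuous fun u : (ℝ →ᵇ ℝ) × ℝ => u.1 |u.2| := by
  fun_prop

theorem hasStrictFDerivAt_flowMap (u : (ℝ →ᵇ ℝ) × ℝ) :
    HasStrictFDerivAt (fun u : (ℝ →ᵇ ℝ) × ℝ => flowMap u.1 u.2)
      ((displacement u.2).coprod (ContinuousLinearMap.toSpanSingleton ℝ (1 + u.1 |u.2|))) u := by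
  refine hasStrictFDerivAt_uncurry_coprod (f := flowMap) (f₁ := fun _ x => displacement x)
    (f₂ := fun v x => ContinuousLinearMap.toSpanSingleton ℝ (1 + v |x|)) ?_ ?_ ?_ ?_
  · exact Eventually.of_forall fun u => (displacement u.2).hasFDerivAt.const_add u.2
  · exact Eventually.of_forall fun u => (hasDerivAt_flowMap u.1 u.2).hasFDerivAt
  · exact (continuous_displacement.comp continuous_snd).continuousAt
  · exact ((ContinuousLinearMap.toSpanSingletonCLE (𝕜 := ℝ) (E := ℝ)).continuous.comp
      (continuous_const.add continuous_eval_abs)).continuousAt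

theorem contDiff_flowMap : ContDiff ℝ 1 fun u : (ℝ →ᵇ ℝ) × ℝ => flowMap u.1 u.2 := by
  refine contDiff_one_iff_hasFDerivAt.2
    ⟨_, ?_, fun u => (hasStrictFDerivAt_flowMap u).hasFDerivAt⟩
  exact (continuous_displacement.comp continuous_snd).continuousLinearMapCoprod
    ((ContinuousLinearMap.toSpanSingletonCLE (𝕜 := ℝ) (E := ℝ)).continuous.comp
      (continuous_const.add continuous_eval_abs))

/-- The inverse of the flow map. -/
def labelMap (v : ℝ →ᵇ ℝ) : ℝ → ℝ := Function.invFun (flowMap v)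

section label

variable {v : ℝ →ᵇ ℝ}

theorem labelMap_flowMap (hv : ‖v‖ ≤ 1 / 2) (x : ℝ) : labelMap v (flowMap v x) = x :=
  Function.leftInverse_invFun (flowMap_bijective hv).1 x

theorem flowMap_labelMap (hv : ‖v‖ ≤ 1 / 2) (x : ℝ) : flowMap v (labelMap v x) = x :=
  Function.rightInverse_invFun (flowMap_bijective hv).2 x

theorem labelMap_neg (hv : ‖v‖ ≤ 1 / 2) (x : ℝ) : labelMap v (-x) = -labelMap v x := by
  apply (flowMap_bijective hv).1
  rw [flowMap_neg, flowMap_labelMap hv, flowMap_labelMap hv]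

theorem abs_labelMap_le (hv : ‖v‖ ≤ 1 / 2) (x : ℝ) : |labelMap v x| ≤ 2 * |x| := by
  have := abs_sub_le_two_mul_abs_flowMap_sub hv (labelMap v x) 0
  rw [flowMap_labelMap hv, flowMap_zero, sub_zero, sub_zero] at this
  linarith

theorem abs_le_abs_labelMap (hv : ‖v‖ ≤ 1 / 2) (x : ℝ) : |x| ≤ 3 / 2 * |labelMap v x| := by
  have := abs_flowMap_sub_le hv (labelMap v x) 0
  rwa [flowMap_labelMap hv, flowMap_zero, sub_zero, sub_zero] at this

/-- The lower Lipschitz bound for the flow, uniform over the ball, dominates the change of label by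
twice the error of the old label under the new flow, which tends to `0`. -/
theorem continuousOn_labelMap : ContinuousOn (fun u : (ℝ →ᵇ ℝ) × ℝ => labelMap u.1 u.2)
    (Metric.ball 0 (1 / 2) ×ˢ univ) := by
  intro u₀ hu₀
  have hball : ∀ u ∈ Metric.ball (0 : ℝ →ᵇ ℝ) (1 / 2) ×ˢ (univ : Set ℝ), ‖u.1‖ ≤ 1 / 2 :=
    fun u hu => (mem_ball_zero_iff.1 hu.1).le
  rw [ContinuousWithinAt, tendsto_iff_dist_tendsto_zero]
  have hlim : Tendsto (fun u : (ℝ →ᵇ ℝ) × ℝ => 2 * |u.2 - flowMap u.1 (labelMap u₀.1 u₀.2)|)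
      (𝓝[Metric.ball 0 (1 / 2) ×ˢ univ] u₀) (𝓝 0) := by
    have hc : Continuous fun u : (ℝ →ᵇ ℝ) × ℝ =>
        2 * |u.2 - flowMap u.1 (labelMap u₀.1 u₀.2)| := by
      have := contDiff_flowMap.continuous.comp
        ((continuous_fst (X := ℝ →ᵇ ℝ) (Y := ℝ)).prodMk
          (continuous_const (y := labelMap u₀.1 u₀.2)))
      exact continuous_const.mul ((continuous_snd.sub this).abs)
    have h := hc.tendsto u₀
    simp only [flowMap_labelMap (hball u₀ hu₀), sub_self, abs_zero, mul_zero] at h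
    exact h.mono_left nhdsWithin_le_nhds
  refine squeeze_zero' (Eventually.of_forall fun _ => dist_nonneg) ?_ hlim
  filter_upwards [self_mem_nhdsWithin] with u hu
  rw [Real.dist_eq]
  have := abs_sub_le_two_mul_abs_flowMap_sub (hball u hu) (labelMap u.1 u.2) (labelMap u₀.1 u₀.2)
  rw [flowMap_labelMap (hball u hu)] at this
  linarith

theorem continuous_labelMap (hv : ‖v‖ < 1 / 2) : Continuous (labelMap v) := by
  rw [← continuousOn_univ]
  exact continuousOn_labelMap.comp (f := fun x : ℝ => (v, x)) (by fun_prop)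
    fun x _ => ⟨by simpa using hv, mem_univ _⟩

theorem hasDerivAt_labelMap (hv : ‖v‖ < 1 / 2) (x : ℝ) :
    HasDerivAt (labelMap v) (1 + v |labelMap v x|)⁻¹ x :=
  HasDerivAt.of_local_left_inverse (continuous_labelMap hv).continuousAt
    (hasDerivAt_flowMap v (labelMap v x))
    (by linarith [half_le_one_add hv.le |labelMap v x|] : 0 < 1 + v |labelMap v x|).ne'
    (Eventually.of_forall (flowMap_labelMap hv.le))

end label

/-- The map `(v, x) ↦ (v, flowMap v x)` with its inverse. -/
def flowHomeomorph : OpenPartialHomeomorph ((ℝ →ᵇ ℝ) × ℝ) ((ℝ →ᵇ ℝ) × ℝ) where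
  toFun u := (u.1, flowMap u.1 u.2)
  invFun u := (u.1, labelMap u.1 u.2)
  source := Metric.ball 0 (1 / 2) ×ˢ univ
  target := Metric.ball 0 (1 / 2) ×ˢ univ
  map_source' _ hu := ⟨hu.1, mem_univ _⟩
  map_target' _ hu := ⟨hu.1, mem_univ _⟩
  left_inv' u hu := by
    have : ‖u.1‖ ≤ 1 / 2 := (mem_ball_zero_iff.1 hu.1).le
    simp only [labelMap_flowMap this]
  right_inv' u hu := by
    have : ‖u.1‖ ≤ 1 / 2 := (mem_ball_zero_iff.1 hu.1).le
    simp only [flowMap_labelMap this]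
  continuousOn_toFun := (continuous_fst.prodMk contDiff_flowMap.continuous).continuousOn
  continuousOn_invFun := continuous_fst.continuousOn.prodMk continuousOn_labelMap
  open_source := Metric.isOpen_ball.prod isOpen_univ
  open_target := Metric.isOpen_ball.prod isOpen_univ

/-- The invertible map `(w, h) ↦ (w, l w + c h)`. -/
def shearEquiv (l : (ℝ →ᵇ ℝ) →L[ℝ] ℝ) {c : ℝ} (hc : c ≠ 0) :
    ((ℝ →ᵇ ℝ) × ℝ) ≃L[ℝ] ((ℝ →ᵇ ℝ) × ℝ) :=
  ContinuousLinearEquiv.equivOfInverse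
    ((ContinuousLinearMap.fst ℝ _ _).prod (l.coprod (ContinuousLinearMap.toSpanSingleton ℝ c)))
    ((ContinuousLinearMap.fst ℝ _ _).prod
      (c⁻¹ • (ContinuousLinearMap.snd ℝ _ _ - l.comp (ContinuousLinearMap.fst ℝ _ _))))
    (fun u => by
      ext
      · simp
      · simp [field])
    (fun u => by
      ext
      · simp
      · simp [field])

/-- Carrying `v` along as a component, the flow becomes a self-map of a Banach space whose
derivative is a shear, invertible because `1 + v ≥ 1/2`. Differentiability of the inverse then gives
joint regularity in `(v, x)`. -/
theorem contDiffOn_labelMap : ContDiffOn ℝ 1 (fun u : (ℝ →ᵇ ℝ) × ℝ => labelMap u.1 u.2)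
    (Metric.ball 0 (1 / 2) ×ˢ univ) := by
  intro u hu
  have hv : ‖u.1‖ ≤ 1 / 2 := (mem_ball_zero_iff.1 hu.1).le
  have hc : 1 + u.1 |labelMap u.1 u.2| ≠ 0 := by
    have := half_le_one_add hv |labelMap u.1 u.2|
    exact (by linarith : 0 < 1 + u.1 |labelMap u.1 u.2|).ne'
  have h := flowHomeomorph.contDiffAt_symm (𝕜 := ℝ) (n := 1) (a := u)
    (f₀' := shearEquiv (displacement (labelMap u.1 u.2)) hc) hu
    (hasFDerivAt_fst.prodMk (hasStrictFDerivAt_flowMap (u.1, labelMap u.1 u.2)).hasFDerivAt)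
    (contDiff_fst.prodMk contDiff_flowMap).contDiffAt
  exact h.snd.contDiffWithinAt

/-! ### Existence -/

/-! ### The transported function and its velocity -/

section transported

variable {γ q M N : ℝ} {ω₀ g : ℝ → ℝ} {v : ℝ →ᵇ ℝ}

theorem hasDerivAt_comp_labelMap (hω₀ : ∀ x, HasDerivAt ω₀ (g x) x) (hv : ‖v‖ < 1 / 2) (x : ℝ) :
    HasDerivAt (fun x => ω₀ (labelMap v x)) (g (labelMap v x) * (1 + v |labelMap v x|)⁻¹) x :=
  (hω₀ (labelMap v x)).comp x (hasDerivAt_labelMap hv x)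

theorem abs_comp_labelMap_le (hq : 0 < q) (hq1 : q < 1) (hN : 0 ≤ N)
    (hωN : ∀ y, |ω₀ y| ≤ N * (1 + |y|) ^ q) (hv : ‖v‖ ≤ 1 / 2) (x : ℝ) :
    |ω₀ (labelMap v x)| ≤ 2 * N * (1 + |x|) ^ q := by
  have h1 := abs_labelMap_le hv x
  calc |ω₀ (labelMap v x)| ≤ N * (1 + |labelMap v x|) ^ q := hωN _
    _ ≤ N * (2 * (1 + |x|)) ^ q := by
        gcongr
        linarith [abs_nonneg x]
    _ = N * (2 ^ q * (1 + |x|) ^ q) := by rw [Real.mul_rpow (by norm_num) (by positivity)]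
    _ ≤ N * (2 ^ (1 : ℝ) * (1 + |x|) ^ q) := by
        gcongr
        norm_num
    _ = _ := by rw [Real.rpow_one]; ring

theorem abs_deriv_comp_labelMap_le (hq : 0 < q) (hq1 : q < 1) (hM : 0 ≤ M)
    (hgM : ∀ y, |g y| ≤ M * (1 + |y|) ^ (q - 1)) (hv : ‖v‖ ≤ 1 / 2) (x : ℝ) :
    |g (labelMap v x) * (1 + v |labelMap v x|)⁻¹| ≤ 4 * M * (1 + |x|) ^ (q - 1) := by
  have h1 := abs_le_abs_labelMap hv x
  have h2 := half_le_one_add hv |labelMap v x|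
  have h3 : |(1 + v |labelMap v x|)⁻¹| ≤ 2 := by
    rw [abs_inv, abs_of_pos (by linarith), inv_le_comm₀ (by linarith) (by norm_num)]
    linarith
  have h4 : (1 + |labelMap v x|) ^ (q - 1) ≤ 2 * (1 + |x|) ^ (q - 1) := by
    calc (1 + |labelMap v x|) ^ (q - 1) ≤ ((1 + |x|) / 2) ^ (q - 1) :=
          Real.rpow_le_rpow_of_nonpos (by positivity)
            (by linarith [abs_nonneg (labelMap v x)]) (by linarith)
      _ = 2 ^ (1 - q) * (1 + |x|) ^ (q - 1) := by
          rw [Real.div_rpow (by positivity) (by norm_num), div_eq_mul_inv,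
            ← Real.rpow_neg (by norm_num), neg_sub, mul_comm]
      _ ≤ 2 ^ (1 : ℝ) * (1 + |x|) ^ (q - 1) := by
          gcongr
          · norm_num
          · linarith
      _ = _ := by rw [Real.rpow_one]
  rw [abs_mul]
  calc _ ≤ (M * (1 + |labelMap v x|) ^ (q - 1)) * 2 := by
        have := hgM (labelMap v x)
        gcongr
    _ ≤ (M * (2 * (1 + |x|) ^ (q - 1))) * 2 := by gcongr
    _ = _ := by ring

/-- In the change of variables by the flow, the Jacobian `1 + v |y|` cancels the factor in the
derivative of `ω₀ ∘ labelMap v`. -/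
theorem neg_integral_eq_strain (hv : ‖v‖ ≤ 1 / 2) (a : ℝ) :
    -∫ y, |flowMap v a - y| ^ (-γ) * (g (labelMap v y) * (1 + v |labelMap v y|)⁻¹) =
      strain γ g v a := by
  have h := integral_image_eq_integral_abs_deriv_smul (s := univ) (f := flowMap v)
    (f' := fun x => 1 + v |x|) MeasurableSet.univ
    (fun x _ => (hasDerivAt_flowMap v x).hasDerivWithinAt) (flowMap_bijective hv).1.injOn
    (fun y => |flowMap v a - y| ^ (-γ) * (g (labelMap v y) * (1 + v |labelMap v y|)⁻¹))
  rw [image_univ, (flowMap_bijective hv).2.range_eq, setIntegral_univ, setIntegral_univ] at h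
  rw [h, strain]
  congr 1
  refine integral_congr_ae (ae_of_all _ fun y => ?_)
  have h2 : 0 < 1 + v |y| := by linarith [half_le_one_add hv |y|]
  simp only [labelMap_flowMap hv, smul_eq_mul, abs_of_pos h2]
  field_simp

/-- The velocity along the flow map is the displacement of the Lagrangian vector field. -/
theorem velocity_comp_labelMap (hq : 0 < q) (hqγ : q < γ) (hγ1 : γ < 1)
    (hω₀ : ∀ x, HasDerivAt ω₀ (g x) x) (hodd : ∀ x, ω₀ (-x) = -ω₀ x) (heven : ∀ x, g (-x) = g x)
    (hgc : Continuous g) (hN : 0 ≤ N) (hM : 0 ≤ M) (hωN : ∀ y, |ω₀ y| ≤ N * (1 + |y|) ^ q)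
    (hgM : ∀ y, |g y| ≤ M * (1 + |y|) ^ (q - 1)) (hv : ‖v‖ < 1 / 2) (a : ℝ) :
    velocity γ (fun x => ω₀ (labelMap v x)) (flowMap v a) =
      displacement a (lagrangianField γ g v) := by
  have hlc := continuous_labelMap hv
  have hvc := v.continuous
  have hpos : ∀ y, 0 < 1 + v |y| := fun y => by linarith [half_le_one_add hv.le |y|]
  have hω₀0 : ω₀ 0 = 0 := by
    have := hodd 0
    rw [neg_zero] at this
    linarith
  have hl0 : labelMap v 0 = 0 := by
    have := labelMap_flowMap hv.le 0
    rwa [flowMap_zero] at this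
  have hstrain := continuous_strain hq hqγ hγ1 hM hgc hgM hv.le
  rw [velocity_eq_integral (f' := fun x => g (labelMap v x) * (1 + v |labelMap v x|)⁻¹)
    (N := 2 * N) (M := 4 * M) hq hqγ hγ1 (hasDerivAt_comp_labelMap hω₀ hv)
    (by rw [hl0, hω₀0]) (fun y => by rw [labelMap_neg hv.le, heven, abs_neg])
    (by
      refine (hgc.comp hlc).mul (Continuous.inv₀ (by fun_prop) fun y => (hpos _).ne'))
    (by positivity)
    (fun y hy => by
      have := abs_comp_labelMap_le hq (hqγ.trans hγ1) hN hωN hv.le y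
      rwa [abs_of_pos hy] at this)
    (abs_deriv_comp_labelMap_le hq (hqγ.trans hγ1) hM hgM hv.le)]
  have hU : (fun s => -∫ y, |s - y| ^ (-γ) * (g (labelMap v y) * (1 + v |labelMap v y|)⁻¹)) =
      fun s => strain γ g v (labelMap v s) := by
    funext s
    have := neg_integral_eq_strain (γ := γ) (g := g) hv.le (labelMap v s)
    rwa [flowMap_labelMap hv.le] at this
  rw [hU]
  -- The substitution by the flow supplies the factor `1 + v |s|` that turns the strain into the
  -- Lagrangian field.
  have hsub := intervalIntegral.integral_comp_mul_deriv (a := 0) (b := a) (f := flowMap v)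
    (f' := fun x => 1 + v |x|) (g := fun s => strain γ g v (labelMap v s))
    (fun x _ => hasDerivAt_flowMap v x) (by fun_prop) (hstrain.comp hlc)
  rw [flowMap_zero] at hsub
  rw [← hsub, displacement_apply]
  refine intervalIntegral.integral_congr fun s _ => ?_
  simp only [Function.comp, labelMap_flowMap hv.le]
  rw [lagrangianField_apply hq hqγ hγ1 hM hgc hgM hv.le, strain_abs heven, mul_comm]

end transported

/-- The derivative bound, uniform in time, is recorded because uniqueness rests on it. -/
theorem exists_solution {γ q M N : ℝ} {ω₀ : ℝ → ℝ} (hq : 0 < q) (hqγ : q < γ) (hγ1 : γ < 1)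
    (hω₀ : ContDiff ℝ 1 ω₀) (hodd : ∀ x, ω₀ (-x) = -ω₀ x)
    (heven : ∀ x, deriv ω₀ (-x) = deriv ω₀ x) (hN : 0 ≤ N) (hM : 0 ≤ M)
    (hωN : ∀ y, |ω₀ y| ≤ N * (1 + |y|) ^ q)
    (hgM : ∀ y, |deriv ω₀ y| ≤ M * (1 + |y|) ^ (q - 1)) :
    ∃ T : ℝ, 0 < T ∧ ∃ ω : ℝ → ℝ → ℝ, IsSolution γ q T ω₀ ω ∧
      ∀ t ∈ Icc 0 T, ∀ x, 0 ≤ x → |deriv (ω t) x| ≤ 4 * M * (1 + x) ^ (q - 1) := by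
  have hgc : Continuous (deriv ω₀) := hω₀.continuous_deriv le_rfl
  have hd : ∀ x, HasDerivAt ω₀ (deriv ω₀ x) x := fun x =>
    (hω₀.differentiable (by norm_num) x).hasDerivAt
  obtain ⟨T', hT', v, hv0, hvn, hvC, hvd⟩ :=
    exists_lagrangian_solution hq hqγ hγ1 hM hgc hgM
  -- Halving keeps the closed interval inside the open one, so one-sided time derivatives come from
  -- two-sided ones.
  have hsub : Icc 0 (T' / 2) ⊆ Ioo (-T') T' := fun t ht =>
    ⟨by linarith [ht.1], by linarith [ht.2]⟩
  set ω : ℝ → ℝ → ℝ := fun t x => ω₀ (labelMap (v t) x) with hω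
  have hC : ContDiffOn ℝ 1 (fun p : ℝ × ℝ => ω p.1 p.2) (Ioo (-T') T' ×ˢ univ) := by
    refine hω₀.comp_contDiffOn (contDiffOn_labelMap.comp (f := fun p : ℝ × ℝ => (v p.1, p.2))
      ((hvC.comp contDiff_fst.contDiffOn fun p hp => hp.1).prodMk contDiff_snd.contDiffOn)
      fun p hp => ⟨mem_ball_zero_iff.2 (hvn p.1 hp.1), mem_univ _⟩)
  have hdx : ∀ t ∈ Icc 0 (T' / 2), ∀ x, deriv (ω t) x =
      deriv ω₀ (labelMap (v t) x) * (1 + v t |labelMap (v t) x|)⁻¹ := fun t ht x =>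
    (hasDerivAt_comp_labelMap hd (hvn t (hsub ht)) x).deriv
  have hdbound : ∀ t ∈ Icc 0 (T' / 2), ∀ x, 0 ≤ x →
      |deriv (ω t) x| ≤ 4 * M * (1 + x) ^ (q - 1) := by
    intro t ht x hx
    rw [hdx t ht x]
    have := abs_deriv_comp_labelMap_le hq (hqγ.trans hγ1) hM hgM (hvn t (hsub ht)).le x
    rwa [abs_of_nonneg hx] at this
  refine ⟨T' / 2, by positivity, ω, ⟨hC.mono (prod_mono_left hsub), ?_, ?_, ?_, ?_⟩, hdbound⟩
  · intro t ht x
    simp only [hω, labelMap_neg (hvn t (hsub ht)).le, hodd]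
  · intro t ht
    refine ENNReal.add_lt_top.2 ⟨weightedNorm_lt_top_of_bound (N := 2 * N) fun x hx => ?_,
      weightedNorm_lt_top_of_bound (hdbound t ht)⟩
    have := abs_comp_labelMap_le hq (hqγ.trans hγ1) hN hωN (hvn t (hsub ht)).le x
    rwa [abs_of_nonneg hx] at this
  · intro x
    have h0 : ‖v 0‖ ≤ 1 / 2 := (hvn 0 ⟨by linarith, hT'⟩).le
    have : labelMap (v 0) x = x := by
      have h := flowMap_labelMap h0 x
      rw [hv0] at h ⊢
      simpa [flowMap] using h
    simp only [hω, this]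
  · intro t ht x
    have htI := hsub ht
    have hvt := hvn t htI
    set a := labelMap (v t) x with ha
    have hxa : flowMap (v t) a = x := flowMap_labelMap hvt.le x
    have hopen : Ioo (-T') T' ×ˢ (univ : Set ℝ) ∈ 𝓝 (t, x) :=
      (isOpen_Ioo.prod isOpen_univ).mem_nhds ⟨htI, mem_univ _⟩
    have hF : HasFDerivAt (fun p : ℝ × ℝ => ω p.1 p.2)
        (fderiv ℝ (fun p : ℝ × ℝ => ω p.1 p.2) (t, x)) (t, x) :=
      ((hC.contDiffAt hopen).differentiableAt (by norm_num)).hasFDerivAt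
    set D := fderiv ℝ (fun p : ℝ × ℝ => ω p.1 p.2) (t, x)
    have h1 : HasDerivAt (fun s => ω s x) (D (1, 0)) t :=
      hF.comp_hasDerivAt (f := fun s => (s, x)) t
        ((hasDerivAt_id t).prodMk (hasDerivAt_const t x))
    have h2 : HasDerivAt (ω t) (D (0, 1)) x :=
      hF.comp_hasDerivAt (f := fun y => (t, y)) x
        ((hasDerivAt_const x t).prodMk (hasDerivAt_id x))
    have h3 : HasDerivAt (fun s => flowMap (v s) a)
        (displacement a (lagrangianField γ (deriv ω₀) (v t))) t :=
      ((displacement a).hasFDerivAt.comp_hasDerivAt t (hvd t htI)).const_add a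
    -- `ω` is constant along the trajectory of `a`; the chain rule then reads `ω_t + X_t ω_x = 0`,
    -- and `X_t` is the velocity by `velocity_comp_labelMap`.
    have h4 : HasDerivAt (fun s => ω s (flowMap (v s) a))
        (D (1, displacement a (lagrangianField γ (deriv ω₀) (v t)))) t := by
      have hF' : HasFDerivAt (fun p : ℝ × ℝ => ω p.1 p.2) D (t, flowMap (v t) a) := by
        rw [hxa]; exact hF
      exact hF'.comp_hasDerivAt (f := fun s => (s, flowMap (v s) a)) t
        ((hasDerivAt_id t).prodMk h3)
    have h5 : HasDerivAt (fun s => ω s (flowMap (v s) a)) 0 t := by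
      refine (hasDerivAt_const t (ω₀ a)).congr_of_eventuallyEq ?_
      filter_upwards [isOpen_Ioo.mem_nhds htI] with s hs
      simp only [hω, labelMap_flowMap (hvn s hs).le]
    have h6 := h4.unique h5
    have h7 : D (1, displacement a (lagrangianField γ (deriv ω₀) (v t))) =
        D (1, 0) + displacement a (lagrangianField γ (deriv ω₀) (v t)) * D (0, 1) := by
      rw [← smul_eq_mul, ← map_smul, ← map_add]
      congr 1
      simp
    have h8 : velocity γ (ω t) x = displacement a (lagrangianField γ (deriv ω₀) (v t)) := by
      rw [← velocity_comp_labelMap hq hqγ hγ1 hd hodd heven hgc hN hM hωN hgM hvt a, hxa]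
    rw [h1.hasDerivWithinAt.derivWithin (uniqueDiffOn_Icc (by positivity) t ht), h2.deriv, h8,
      ← h7, h6]

end AlphaPatch

end

theorem theorem1 (α γ q : ℝ) (hα : α ∈ Set.Ioo (0 : ℝ) 1) (hγ : γ = 1 - α)
    (hq : 0 < q) (hqγ : q < γ) (ω₀ : ℝ → ℝ) (hω₀ : ContDiff ℝ 2 ω₀)
    (hodd : ∀ x, ω₀ (-x) = -ω₀ x)
    (hnorm : AlphaPatch.weightedNorm q ω₀ + AlphaPatch.weightedNorm (q - 1) (deriv ω₀)
      + AlphaPatch.weightedNorm (q - 2) (deriv (deriv ω₀)) < ⊤) :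
    ∃ T : ℝ, 0 < T ∧
      (∃ ω : ℝ → ℝ → ℝ, AlphaPatch.IsSolution γ q T ω₀ ω) ∧
      ∀ ω₁ ω₂ : ℝ → ℝ → ℝ, AlphaPatch.IsSolution γ q T ω₀ ω₁ →
        AlphaPatch.IsSolution γ q T ω₀ ω₂ →
        ∀ t ∈ Set.Icc 0 T, ∀ x, ω₁ t x = ω₂ t x := by
  have hγ1 : γ < 1 := by linarith [hα.1]
  have hsum := (ENNReal.add_lt_top.1 (ENNReal.add_lt_top.1 hnorm).1)
  obtain ⟨N, hN, hωN⟩ := AlphaPatch.exists_bound_of_weightedNorm_lt_top hsum.1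
  obtain ⟨M, hM, hgM⟩ := AlphaPatch.exists_bound_of_weightedNorm_lt_top hsum.2
  have heven : ∀ x, deriv ω₀ (-x) = deriv ω₀ x := by
    intro x
    have h1 : deriv (fun y => ω₀ (-y)) x = -deriv ω₀ (-x) := deriv_comp_neg ω₀ x
    have h2 : (fun y => ω₀ (-y)) = fun y => -ω₀ y := funext hodd
    rw [h2, deriv.fun_neg] at h1
    linarith
  -- The norms only see `x ≥ 0`; parity extends the bounds to the line.
  have hωN' : ∀ y, |ω₀ y| ≤ N * (1 + |y|) ^ q := by
    intro y
    have h := hωN |y| (abs_nonneg y)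
    rcases abs_choice y with hy | hy
    · rwa [show ω₀ |y| = ω₀ y by rw [hy]] at h
    · rwa [show |ω₀ (|y|)| = |ω₀ y| by rw [hy, hodd, abs_neg]] at h
  have hgM' : ∀ y, |deriv ω₀ y| ≤ M * (1 + |y|) ^ (q - 1) := by
    intro y
    have h := hgM |y| (abs_nonneg y)
    rcases abs_choice y with hy | hy
    · rwa [show deriv ω₀ |y| = deriv ω₀ y by rw [hy]] at h
    · rwa [show deriv ω₀ |y| = deriv ω₀ y by rw [hy, heven]] at h
  obtain ⟨T, hT, ω, hω, hωd⟩ := AlphaPatch.exists_solution hq hqγ hγ1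
    (hω₀.of_le (by norm_num)) hodd heven hN hM hωN' hgM'
  refine ⟨T, hT, ⟨ω, hω⟩, fun ω₁ ω₂ h₁ h₂ t ht x => ?_⟩
  -- Both solutions are compared with the constructed one, the only one whose derivative is known to
  -- be bounded uniformly in time.
  rw [hω.eq_of_uniform_deriv_bound hq hqγ hγ1 h₁ (by positivity) hωd t ht x,
    hω.eq_of_uniform_deriv_bound hq hqγ hγ1 h₂ (by positivity) hωd t ht x]
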